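/- For $N\ge 1$ let $G_N$ be a simple graph on $\{1,\dots,N\}$ with adjacency matrix $A(G_N)$, and suppose that $G_N$ converges in cut metric to a graphon $W$, i.e. a measurable symmetric $W:[0,1]^2\to[0,1]$: writing $W_{G_N}(x,y)=1$ if $\lceil Nx\rceil$ and $\lceil Ny\rceil$ are adjacent in $G_N$ and $W_{G_N}(x,y)=0$ otherwise, $$\inf_{\varphi}\ \sup_{S,T}\Bigl|\int_{S\times T}\bigl(W_{G_N}(x,y)-W(\varphi(x),\varphi(y))\bigr)\,dx\,dy\Bigr|\longrightarrow 0 ,$$ where $\varphi$ ranges over the invertible measure-preserving maps of $[0,1]$ and $S,T$ over the measurable subsets of $[0,1]$. Assume $\int_{[0,1]^2}W(x,y)\,dx\,dy>0$, and let $\|W\|$ be the operator norm of $(T_Wf)(x)=\int_0^1W(x,y)f(y)\,dy$ on $L^2[0,1]$. For real $\beta\ge0$ let $\mathbb P_\beta$ be the Ising model on $\{-1,1\}^N$, $$\mathbb P_\beta(\sigma=\tau)=2^{-N}\exp\bigl\{\tfrac12\beta H_N(\tau)-F_N(\beta)\bigr\},\qquad H_N(\tau)=\tfrac1N\tau'A(G_N)\tau,\qquad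 F_N(\beta)=\log\Bigl(2^{-N}\sum_{\tau\in\{-1,1\}^N} e^{\frac12\beta H_N(\tau)}\Bigr).$$ Let $\hat\beta_N(\sigma)$ be the maximum pseudolikelihood estimator (MPLE) $$\hat\beta_N(\sigma)=\inf\{x\ge0: L_\sigma(x)=0\}\in[0,\infty],\quad L_\tau(x)=\frac1N\sum_{i=1}^N m_i(\tau)\bigl(\tau_i-\tanh(x\,m_i(\tau))\bigr),\quad m_i(\tau)=\frac1N\sum_{j=1}^N A(G_N)_{ij}\tau_j ,$$ where $\inf\emptyset=\infty$. Then: (a) If $0\le\beta_1<\beta_2<1/\|W\|$, there is no consistent sequence of tests of $\beta=\beta_1$ versus $\beta=\beta_2$ based on a single realization $\sigma\in\{-1,1\}^N$: there are no functions $\phi_N:\{-1,1\}^N\to\{0,1\}$ with $\lim_{N\to\infty}\mathbb E_{\beta_1}\phi_N=0$ and $\lim_{N\to\infty}\mathbb E_{\beta_2}\phi_N=1$. (b) If $\beta_0>1/\|W\|$, then $\hat\beta_N$ is $\sqrt N$-consistent at $\beta_0$: $\limsup_{K\to\infty}\limsup_{N\to\infty}\mathbb P_{\beta_0}\bigl(\sqrt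 N\,|\hat\beta_N(\sigma)-\beta_0|>K\bigr)=0$. -/

import Mathlib

open MeasureTheory Filter Topology
open scoped unitInterval ENNReal NNReal

noncomputable section

namespace IsingGraphon

/-! Ising models with a general coupling matrix -/

/-- Spin configurations in `{-1, 1}^N`: `ℤˣ` consists of exactly `1` and `-1`. -/
abbrev Spins (N : ℕ) : Type := Fin N → ℤˣ

/-- The spin at site `i`, as a real number (`1` or `-1`). -/
def spin {N : ℕ} (τ : Spins N) (i : Fin N) : ℝ := ((τ i : ℤ) : ℝ)

/-- The quadratic form `H_N(τ) = τ' J τ`. -/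
def energy {N : ℕ} (J : Matrix (Fin N) (Fin N) ℝ) (τ : Spins N) : ℝ :=
  ∑ i, ∑ j, J i j * spin τ i * spin τ j

/-- The log-partition function `F_N(β) = log (2^{-N} ∑_τ exp (β H_N(τ) / 2))`. -/
def logPartition {N : ℕ} (J : Matrix (Fin N) (Fin N) ℝ) (β : ℝ) : ℝ :=
  Real.log ((1 / 2 ^ N) * ∑ τ : Spins N, Real.exp (1 / 2 * β * energy J τ))

/-- The Ising probability mass function
`P_β(σ = τ) = 2^{-N} exp (β H_N(τ) / 2 - F_N(β))`. -/
def isingProb {N : ℕ} (J : Matrix (Fin N) (Fin N) ℝ) (β : ℝ) (τ : Spins N) : ℝ :=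
  (1 / 2 ^ N) * Real.exp (1 / 2 * β * energy J τ - logPartition J β)

theorem isingProb_pos {N : ℕ} (J : Matrix (Fin N) (Fin N) ℝ) (β : ℝ) (τ : Spins N) :
    0 < isingProb J β τ := by
  unfold isingProb
  positivity

theorem sum_isingProb {N : ℕ} (J : Matrix (Fin N) (Fin N) ℝ) (β : ℝ) :
    ∑ τ : Spins N, isingProb J β τ = 1 := by
  have hpos : 0 < (1 / 2 ^ N : ℝ) * ∑ τ : Spins N, Real.exp (1 / 2 * β * energy J τ) :=
    mul_pos (by positivity)
      (Finset.sum_pos (fun _ _ => Real.exp_pos _) Finset.univ_nonempty)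
  simp only [isingProb, Real.exp_sub, logPartition, Real.exp_log hpos]
  rw [← Finset.mul_sum, ← Finset.sum_div, ← mul_div_assoc, div_self hpos.ne']

/-- The expectation `E_β f(σ)` for `σ ∼ P_β`. -/
def isingExp {N : ℕ} (J : Matrix (Fin N) (Fin N) ℝ) (β : ℝ) (f : Spins N → ℝ) : ℝ :=
  ∑ τ : Spins N, isingProb J β τ * f τ

open scoped Classical in
/-- The probability `P_β(σ ∈ E)` of an event `E`. -/
def isingEventProb {N : ℕ} (J : Matrix (Fin N) (Fin N) ℝ) (β : ℝ) (E : Set (Spins N)) : ℝ :=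
  ∑ τ : Spins N with τ ∈ E, isingProb J β τ

/-! Tests -/

/-- A sequence of `{0, 1}`-valued tests `φ_N` is consistent for `β = β₁` versus `β = β₂` if
`E_{β₁} φ_N → 0` and `E_{β₂} φ_N → 1`. -/
def IsConsistentTest (J : ∀ N : ℕ, Matrix (Fin N) (Fin N) ℝ) (β₁ β₂ : ℝ)
    (φ : ∀ N : ℕ, Spins N → Fin 2) : Prop :=
  Tendsto (fun N => isingExp (J N) β₁ (fun τ => ((φ N τ : ℕ) : ℝ))) atTop (𝓝 0) ∧
  Tendsto (fun N => isingExp (J N) β₂ (fun τ => ((φ N τ : ℕ) : ℝ))) atTop (𝓝 1)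

/-! The maximum pseudolikelihood estimator -/

/-- The local field `m_i(τ) = ∑_j J(i, j) τ_j`. -/
def localField {N : ℕ} (J : Matrix (Fin N) (Fin N) ℝ) (τ : Spins N) (i : Fin N) : ℝ :=
  ∑ j, J i j * spin τ j

/-- `L_τ(x) = N⁻¹ ∑_i m_i(τ) (τ_i - tanh (x m_i(τ)))`, the normalized derivative of the
log-pseudolikelihood. -/
def score {N : ℕ} (J : Matrix (Fin N) (Fin N) ℝ) (τ : Spins N) (x : ℝ) : ℝ :=
  (1 / (N : ℝ)) * ∑ i, localField J τ i * (spin τ i - Real.tanh (x * localField J τ i))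

/-- The maximum pseudolikelihood estimator `inf {x ≥ 0 : L_τ(x) = 0}`, an element of `[0, ∞]`;
the infimum of the empty set is `∞`. (A zero of the extension of `L_τ` to `x = ∞` would not
change the infimum.) -/
def mple {N : ℕ} (J : Matrix (Fin N) (Fin N) ℝ) (τ : Spins N) : ℝ≥0∞ :=
  sInf {y : ℝ≥0∞ | ∃ x : ℝ≥0, y = (x : ℝ≥0∞) ∧ score J τ (x : ℝ) = 0}

/-- The event `a |b - β₀| > K` for a `[0, ∞]`-valued estimator `b` of the real number `β₀`;
it always occurs where `b = ∞`. -/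
def deviationEvent {N : ℕ} (b : Spins N → ℝ≥0∞) (β₀ a K : ℝ) : Set (Spins N) :=
  {τ | b τ = ⊤ ∨ K < a * |(b τ).toReal - β₀|}

/-- A sequence of estimators is `a_N`-consistent at `β₀` if `a_N |b_N - β₀| = O_P(1)`
under `P_{β₀}`, that is, `limsup_{K → ∞} limsup_{N → ∞} P_{β₀}(a_N |b_N - β₀| > K) = 0`. -/
def IsConsistentAtRate (J : ∀ N : ℕ, Matrix (Fin N) (Fin N) ℝ)
    (b : ∀ N : ℕ, Spins N → ℝ≥0∞) (a : ℕ → ℝ) (β₀ : ℝ) : Prop :=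
  limsup (fun K : ℝ =>
    limsup (fun N : ℕ => isingEventProb (J N) β₀ (deviationEvent (b N) β₀ (a N) K)) atTop)
    atTop = 0

/-! Graphons and the cut metric -/

/-- Graphons: symmetric measurable functions `[0, 1]² → [0, 1]`. -/
structure Graphon where
  /-- the underlying function -/
  toFun : I → I → ℝ
  measurable' : Measurable (Function.uncurry toFun)
  symm' : ∀ x y, toFun x y = toFun y x
  nonneg' : ∀ x y, 0 ≤ toFun x y
  le_one' : ∀ x y, toFun x y ≤ 1

/-- The cut norm `sup_{S, T} |∫_{S × T} U|`, over measurable sets `S, T ⊆ [0, 1]`. -/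
def cutNorm (U : I → I → ℝ) : ℝ :=
  sSup {r : ℝ | ∃ S T : Set I, MeasurableSet S ∧ MeasurableSet T ∧
    r = |∫ p in S ×ˢ T, U p.1 p.2|}

/-- The cut metric: the infimum of `‖U - W^φ‖_□` over the invertible measure-preserving maps
`φ` of `[0, 1]`, where `W^φ(x, y) = W(φ(x), φ(y))`. -/
def cutDist (U W : Graphon) : ℝ :=
  ⨅ φ : {φ : I ≃ᵐ I // MeasurePreserving φ},
    cutNorm (fun x y => U.toFun x y - W.toFun (φ.1 x) (φ.1 y))

open scoped Classical in
/-- The step function of a graph on `N` vertices: it is `1` at `(x, y)` if the vertices with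
(one-based) numbers `⌈N x⌉` and `⌈N y⌉` are adjacent, and `0` otherwise. -/
def stepFun {N : ℕ} (G : SimpleGraph (Fin N)) (x y : I) : ℝ :=
  if ∃ i j : Fin N, G.Adj i j ∧
    ⌈(N : ℝ) * (x : ℝ)⌉₊ = (i : ℕ) + 1 ∧ ⌈(N : ℝ) * (y : ℝ)⌉₊ = (j : ℕ) + 1 then 1 else 0

theorem measurable_stepFun {N : ℕ} (G : SimpleGraph (Fin N)) :
    Measurable (Function.uncurry (stepFun G)) := by
  classical
  unfold stepFun Function.uncurry
  refine Measurable.ite ?_ measurable_const measurable_const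
  have hx : Measurable (fun p : I × I => ⌈(N : ℝ) * (p.1 : ℝ)⌉₊) :=
    Nat.measurable_ceil.comp ((measurable_subtype_coe.comp measurable_fst).const_mul _)
  have hy : Measurable (fun p : I × I => ⌈(N : ℝ) * (p.2 : ℝ)⌉₊) :=
    Nat.measurable_ceil.comp ((measurable_subtype_coe.comp measurable_snd).const_mul _)
  simp only [Set.ofPred_exists, Set.ofPred_and]
  refine MeasurableSet.iUnion fun i => MeasurableSet.iUnion fun j => ?_
  exact (MeasurableSet.const _).inter
    ((measurableSet_eq_fun hx measurable_const).inter (measurableSet_eq_fun hy measurable_const))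

/-- The graphon of a graph on `N` vertices. -/
def ofGraph {N : ℕ} (G : SimpleGraph (Fin N)) : Graphon where
  toFun := stepFun G
  measurable' := measurable_stepFun G
  symm' x y := by
    unfold stepFun
    congr 1
    refine propext ⟨?_, ?_⟩ <;>
    · rintro ⟨i, j, h, h1, h2⟩
      exact ⟨j, i, h.symm, h2, h1⟩
  nonneg' x y := by unfold stepFun; split_ifs <;> norm_num
  le_one' x y := by unfold stepFun; split_ifs <;> norm_num

/-- Convergence of a sequence of graphs to a graphon in the cut metric. -/
def ConvergesInCutMetric (G : ∀ N : ℕ, SimpleGraph (Fin N)) (W : Graphon) : Prop :=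
  Tendsto (fun N => cutDist (ofGraph (G N)) W) atTop (𝓝 0)

/-! The integral operator of a graphon -/

/-- The function `x ↦ ∫ W(x, y) f(y) dy`. -/
def kernelFun (W : Graphon) (f : I → ℝ) (x : I) : ℝ := ∫ y, W.toFun x y * f y

theorem integrable_of_L2 (f : Lp ℝ 2 (volume : Measure I)) : Integrable (f : I → ℝ) :=
  (Lp.memLp f).integrable (by norm_num)

theorem integrable_kernel (W : Graphon) (f : Lp ℝ 2 (volume : Measure I)) (x : I) :
    Integrable (fun y => W.toFun x y * f y) := by
  refine (integrable_of_L2 f).bdd_mul (c := 1)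
    (W.measurable'.comp measurable_prodMk_left).aestronglyMeasurable ?_
  refine Eventually.of_forall fun y => ?_
  rw [Real.norm_eq_abs, abs_of_nonneg (W.nonneg' x y)]
  exact W.le_one' x y

theorem abs_kernelFun_le (W : Graphon) (f : Lp ℝ 2 (volume : Measure I)) (x : I) :
    ‖kernelFun W f x‖ ≤ ‖f‖ := by
  have h1 : ‖kernelFun W f x‖ ≤ ∫ y, ‖f y‖ := by
    refine norm_integral_le_of_norm_le (integrable_of_L2 f).norm (Eventually.of_forall fun y => ?_)
    rw [norm_mul, Real.norm_eq_abs (W.toFun x y), abs_of_nonneg (W.nonneg' x y)]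
    exact mul_le_of_le_one_left (norm_nonneg _) (W.le_one' x y)
  refine h1.trans ?_
  rw [integral_norm_eq_lintegral_enorm (Lp.aestronglyMeasurable f),
    ← eLpNorm_one_eq_lintegral_enorm, Lp.norm_def]
  exact ENNReal.toReal_mono (Lp.eLpNorm_ne_top f)
    (eLpNorm_le_eLpNorm_of_exponent_le (by norm_num) (Lp.aestronglyMeasurable f))

theorem memLp_kernelFun (W : Graphon) (f : Lp ℝ 2 (volume : Measure I)) :
    MemLp (kernelFun W f) 2 volume := by
  refine MemLp.of_bound ?_ ‖f‖ (Eventually.of_forall (abs_kernelFun_le W f))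
  have h : StronglyMeasurable (fun p : I × I => W.toFun p.1 p.2 * f p.2) :=
    (show Measurable (fun p : I × I => W.toFun p.1 p.2) from W.measurable').stronglyMeasurable.mul
      ((Lp.stronglyMeasurable f).comp_measurable measurable_snd)
  exact h.integral_prod_right.aestronglyMeasurable

/-- The operator `T_W` on `L²[0, 1]`, `(T_W f)(x) = ∫ W(x, y) f(y) dy`. -/
def graphonOp (W : Graphon) : Lp ℝ 2 (volume : Measure I) →L[ℝ] Lp ℝ 2 (volume : Measure I) :=
  LinearMap.mkContinuous
    { toFun := fun f => (memLp_kernelFun W f).toLp _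
      map_add' := fun f g => by
        rw [← MemLp.toLp_add]
        refine MemLp.toLp_congr _ _ (Eventually.of_forall fun x => ?_)
        simp only [kernelFun, Pi.add_apply]
        rw [← integral_add (integrable_kernel W f x) (integrable_kernel W g x)]
        refine integral_congr_ae ?_
        filter_upwards [Lp.coeFn_add f g] with y hy
        rw [hy, Pi.add_apply, mul_add]
      map_smul' := fun c f => by
        rw [RingHom.id_apply, ← MemLp.toLp_const_smul]
        refine MemLp.toLp_congr _ _ (Eventually.of_forall fun x => ?_)
        simp only [kernelFun, Pi.smul_apply, smul_eq_mul]
        rw [← integral_const_mul]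
        refine integral_congr_ae ?_
        filter_upwards [Lp.coeFn_smul c f] with y hy
        rw [hy, Pi.smul_apply, smul_eq_mul]
        ring }
    1 (fun f => by
      rw [one_mul]
      refine (Lp.norm_le_of_ae_bound (norm_nonneg f) (C := ‖f‖) ?_).trans ?_
      · filter_upwards [(memLp_kernelFun W f).coeFn_toLp] with x hx
        exact hx ▸ abs_kernelFun_le W f x
      · simp [measureUnivNNReal])

/-- `‖W‖`, the operator norm of `T_W` on `L²[0, 1]`. -/
def graphonNorm (W : Graphon) : ℝ := ‖graphonOp W‖

/-! The Ising model of a graph -/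

open scoped Classical in
/-- The coupling matrix `J_N = N⁻¹ A(G)`, with `A(G)` the adjacency matrix; the corresponding
quadratic form is `H_N(τ) = N⁻¹ τ' A(G) τ`. -/
def coupling {N : ℕ} (G : SimpleGraph (Fin N)) : Matrix (Fin N) (Fin N) ℝ :=
  (1 / (N : ℝ)) • G.adjMatrix ℝ

end IsingGraphon

end

namespace IsingGraphon

/-! Spins and expectations -/

/-! Both parts rest on the size of `logPartition`: bounded below the threshold, linear in N above
it.

Subcritical regime. `mean_exp_energy_le_det` bounds the partition function by its Gaussian analogue
det(1 - βJ)^(-1/2). Cut convergence keeps the eigenvalues of βJ at most 1 - δ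
(`eventually_eigenvalue_le`). In -log det the first-order term vanishes because J has zero trace,
and the second-order term is controlled by the Hilbert–Schmidt norm, which is at most 1; so
`logPartition_le` gives a bound independent of N. Boundedness at β₁ and at some β₃ > β₂ yields a
contiguity estimate (`isingExp_test_le`): where the energy is at most K the likelihood ratio is
bounded, and larger energies are rare under β₂ by a Chernoff bound. A test whose mean tends to 0
under β₁ therefore cannot have mean tending to 1 under β₂.

Supercritical regime. The mean-field bound `le_logPartition`, tested on small multiples of a
discretized approximate maximizer of the quadratic form of W, gives `logPartition` ≥ κN. Hence the
energy exceeds εN with probability exponentially close to 1, and by Cauchy–Schwarz the mean of m_i²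
is then at least ε². This makes the score strictly decreasing with a slope bounded below near β₀,
while `isingExp_score_sq_le` shows that the score at β₀ has size N^(-1/2). Its zero thus lies within
O(N^(-1/2)) of β₀.

The passage between graphs and W uses that the cut norm controls bilinear forms on uniformly bounded
functions (`abs_kernelForm_le_cutNorm`). Boundedness is available on both sides: eigenvectors of J
with eigenvalue bounded away from 0 are flat, and simple functions are dense in L². -/

theorem spin_eq_one_or {N : ℕ} (τ : Spins N) (i : Fin N) : spin τ i = 1 ∨ spin τ i = -1 := by
  rcases Int.units_eq_one_or (τ i) with h | h <;> simp [spin, h]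

theorem spin_mul_self {N : ℕ} (τ : Spins N) (i : Fin N) : spin τ i * spin τ i = 1 := by
  rcases spin_eq_one_or τ i with h | h <;> simp [h]

theorem abs_spin {N : ℕ} (τ : Spins N) (i : Fin N) : |spin τ i| = 1 := by
  rcases spin_eq_one_or τ i with h | h <;> simp [h]

theorem exp_logPartition {N : ℕ} (J : Matrix (Fin N) (Fin N) ℝ) (β : ℝ) :
    Real.exp (logPartition J β)
      = (1 / 2 ^ N) * ∑ τ : Spins N, Real.exp (1 / 2 * β * energy J τ) := by
  rw [logPartition, Real.exp_log]
  exact mul_pos (by positivity)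
      (Finset.sum_pos (fun _ _ => Real.exp_pos _) Finset.univ_nonempty)

theorem isingProb_eq {N : ℕ} (J : Matrix (Fin N) (Fin N) ℝ) (β : ℝ) (τ : Spins N) :
    isingProb J β τ = (1 / 2 ^ N * Real.exp (-logPartition J β)) *
      Real.exp (1 / 2 * β * energy J τ) := by
  rw [isingProb, sub_eq_add_neg, Real.exp_add]; ring

theorem isingEventProb_nonneg {N : ℕ} (J : Matrix (Fin N) (Fin N) ℝ) (β : ℝ)
    (E : Set (Spins N)) : 0 ≤ isingEventProb J β E :=
  Finset.sum_nonneg fun τ _ => (isingProb_pos J β τ).le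

theorem isingEventProb_mono {N : ℕ} (J : Matrix (Fin N) (Fin N) ℝ) (β : ℝ)
    {E F : Set (Spins N)} (h : E ⊆ F) : isingEventProb J β E ≤ isingEventProb J β F := by
  classical
  refine Finset.sum_le_sum_of_subset_of_nonneg ?_ fun τ _ _ => (isingProb_pos J β τ).le
  intro τ
  simp only [Finset.mem_filter, Finset.mem_univ, true_and]
  exact fun hτ => h hτ

theorem isingEventProb_union_le {N : ℕ} (J : Matrix (Fin N) (Fin N) ℝ) (β : ℝ)
    (E F : Set (Spins N)) :
    isingEventProb J β (E ∪ F) ≤ isingEventProb J β E + isingEventProb J β F := by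
  classical
  simp only [isingEventProb, Finset.sum_filter, ← Finset.sum_add_distrib]
  refine Finset.sum_le_sum fun τ _ => ?_
  have := (isingProb_pos J β τ).le
  by_cases h1 : τ ∈ E <;> by_cases h2 : τ ∈ F <;> simp [h1, h2, this]

/-- Markov's inequality. -/
theorem isingEventProb_le {N : ℕ} (J : Matrix (Fin N) (Fin N) ℝ) (β : ℝ)
    (E : Set (Spins N)) (f : Spins N → ℝ) (hf : ∀ τ, 0 ≤ f τ) (hE : ∀ τ ∈ E, 1 ≤ f τ) :
    isingEventProb J β E ≤ isingExp J β f := by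
  classical
  rw [isingEventProb, isingExp, Finset.sum_filter]
  refine Finset.sum_le_sum fun τ _ => ?_
  have h0 := (isingProb_pos J β τ).le
  split_ifs with h
  · exact le_mul_of_one_le_right h0 (hE τ h)
  · exact mul_nonneg h0 (hf τ)

theorem isingExp_mono {N : ℕ} (J : Matrix (Fin N) (Fin N) ℝ) (β : ℝ) {f g : Spins N → ℝ}
    (h : ∀ τ, f τ ≤ g τ) : isingExp J β f ≤ isingExp J β g :=
  Finset.sum_le_sum fun τ _ => mul_le_mul_of_nonneg_left (h τ) (isingProb_pos J β τ).le

theorem isingExp_const {N : ℕ} (J : Matrix (Fin N) (Fin N) ℝ) (β c : ℝ) :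
    isingExp J β (fun _ => c) = c := by
  rw [isingExp, ← Finset.sum_mul, sum_isingProb, one_mul]

/-- Changing the inverse temperature by exponential tilting. -/
theorem isingExp_exp_energy {N : ℕ} (J : Matrix (Fin N) (Fin N) ℝ) (β γ : ℝ) :
    isingExp J β (fun τ => Real.exp (1 / 2 * (γ - β) * energy J τ))
      = Real.exp (logPartition J γ - logPartition J β) := by
  rw [sub_eq_add_neg (logPartition J γ), Real.exp_add, exp_logPartition J γ, isingExp,
    mul_assoc, Finset.sum_mul, Finset.mul_sum]
  refine Finset.sum_congr rfl fun τ _ => ?_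
  have h : Real.exp (1 / 2 * γ * energy J τ) = Real.exp (1 / 2 * β * energy J τ) *
      Real.exp (1 / 2 * (γ - β) * energy J τ) := by
    rw [← Real.exp_add]; congr 1; ring
  rw [isingProb_eq, h]
  ring

/-! Product measures and the lower bound on the log-partition function -/

theorem sum_prod_spin {N : ℕ} (g : Fin N → ℝ → ℝ) :
    ∑ τ : Spins N, ∏ k, g k (spin τ k) = ∏ k, (g k 1 + g k (-1)) := by
  have h := Finset.prod_univ_sum (fun _ : Fin N => (Finset.univ : Finset ℤˣ))
    (fun k s => g k ((s : ℤ) : ℝ))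
  rw [Fintype.piFinset_univ] at h
  rw [← show _ = ∑ τ : Spins N, ∏ k, g k (spin τ k) from h]
  refine Finset.prod_congr rfl fun k _ => ?_
  rw [show (Finset.univ : Finset ℤˣ) = {1, -1} from rfl, Finset.sum_pair (by decide)]
  simp

/-- The product measure on spins with means `t`. -/
noncomputable def productProb {N : ℕ} (t : Fin N → ℝ) (τ : Spins N) : ℝ :=
  ∏ k, ((1 + t k * spin τ k) / 2)

theorem sum_productProb_mul {N : ℕ} (t : Fin N → ℝ) (i : Fin N) (h : ℝ → ℝ) :
    ∑ τ, productProb t τ * h (spin τ i) = (1 + t i) / 2 * h 1 + (1 - t i) / 2 * h (-1) := by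
  -- The extra factor is spread over all sites as 1 except at i, so that the summand remains a
  -- product over sites.
  have key : ∀ τ : Spins N, productProb t τ * h (spin τ i)
      = ∏ k, (fun x => (1 + t k * x) / 2 * (if k = i then h x else 1)) (spin τ k) := by
    intro τ
    simp only [productProb, Finset.prod_mul_distrib]
    simp
  rw [Finset.sum_congr rfl fun τ _ => key τ,
    sum_prod_spin (fun k x => (1 + t k * x) / 2 * (if k = i then h x else 1)),
    Finset.prod_eq_single i]
  · simp only [↓reduceIte]; ring
  · intro k _ hk
    simp [hk]; ring
  · simp

theorem sum_productProb {N : ℕ} (t : Fin N → ℝ) : ∑ τ, productProb t τ = 1 := by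
  simp_rw [productProb]
  rw [sum_prod_spin (fun k x => (1 + t k * x) / 2)]
  refine Finset.prod_eq_one fun k _ => ?_
  ring

theorem sum_productProb_mul_pair {N : ℕ} (t : Fin N → ℝ) {i j : Fin N} (hij : i ≠ j) :
    ∑ τ, productProb t τ * (spin τ i * spin τ j) = t i * t j := by
  have key : ∀ τ : Spins N, productProb t τ * (spin τ i * spin τ j)
      = ∏ k, (fun x => (1 + t k * x) / 2 * ((if k = i then x else 1) * (if k = j then x else 1)))
        (spin τ k) := by
    intro τ
    simp only [productProb, Finset.prod_mul_distrib]
    simp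
  rw [Finset.sum_congr rfl fun τ _ => key τ,
    sum_prod_spin (fun k x => (1 + t k * x) / 2 *
      ((if k = i then x else 1) * (if k = j then x else 1))),
    ← Finset.mul_prod_erase _ _ (Finset.mem_univ i),
    ← Finset.mul_prod_erase _ _ (Finset.mem_erase.2 ⟨hij.symm, Finset.mem_univ j⟩),
    Finset.prod_eq_one]
  · simp [hij, hij.symm]; ring
  · intro k hk
    simp only [Finset.mem_erase] at hk
    simp [hk.1, hk.2.1]; ring

/-- The difference of the two sides vanishes at 0 and has derivative y³/(1+y), which has the sign of
y. Averaged at ±t with weights (1±t)/2, the bound gives exactly t²/2 + t⁴/3 for the entropy of one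
spin. -/
theorem log_one_add_le {x : ℝ} (hx : -1 < x) : Real.log (1 + x) ≤ x - x ^ 2 / 2 + x ^ 3 / 3 := by
  set f : ℝ → ℝ := fun x => x - x ^ 2 / 2 + x ^ 3 / 3 - Real.log (1 + x) with hf
  have hd : ∀ y, -1 < y → HasDerivAt f (y ^ 3 / (1 + y)) y := by
    intro y hy
    have h1 : HasDerivAt (fun y : ℝ => Real.log (1 + y)) (1 / (1 + y)) y :=
      ((hasDerivAt_id y).const_add 1).log (by simp; linarith)
    have h2 := ((hasDerivAt_id y).sub ((hasDerivAt_pow 2 y).div_const 2)).add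
      ((hasDerivAt_pow 3 y).div_const 3)
    refine (h2.sub h1).congr_deriv ?_
    have : 1 + y ≠ 0 := by linarith
    simp only [Nat.cast_ofNat]
    field_simp
    ring
  have h0 : f 0 = 0 := by simp [hf]
  suffices 0 ≤ f x by simp only [hf] at this; linarith
  rw [← h0]
  rcases le_total 0 x with h | h
  · refine monotoneOn_of_deriv_nonneg (convex_Ici (0 : ℝ)) ?_ ?_ ?_ (Set.mem_Ici.2 le_rfl) h h
    · intro y hy
      exact (hd y (by simp at hy; linarith)).continuousAt.continuousWithinAt
    · intro y hy
      exact (hd y (by simp at hy; linarith)).differentiableAt.differentiableWithinAt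
    · intro y hy
      simp at hy
      rw [(hd y (by linarith)).deriv]; positivity
  · refine antitoneOn_of_deriv_nonpos (convex_Ioc (-1 : ℝ) 0) ?_ ?_ ?_ ⟨hx, h⟩
      (Set.right_mem_Ioc.2 (by norm_num)) h
    · intro y hy
      exact (hd y hy.1).continuousAt.continuousWithinAt
    · intro y hy
      rw [interior_Ioc] at hy
      exact (hd y hy.1).differentiableAt.differentiableWithinAt
    · intro y hy
      rw [interior_Ioc] at hy
      rw [(hd y hy.1).deriv]
      refine div_nonpos_of_nonpos_of_nonneg ?_ (by linarith [hy.1])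
      exact Odd.pow_nonpos (by decide) hy.2.le

/-- The mean-field lower bound on the log-partition function. -/
theorem le_logPartition {N : ℕ} (J : Matrix (Fin N) (Fin N) ℝ) (hJ : ∀ i, J i i = 0) (β : ℝ)
    (t : Fin N → ℝ) (ht : ∀ i, |t i| < 1) :
    1 / 2 * β * ∑ i, ∑ j, J i j * t i * t j - ∑ i, (t i ^ 2 / 2 + t i ^ 4 / 3)
      ≤ logPartition J β := by
  have hpos : ∀ τ : Spins N, ∀ k, 0 < 1 + t k * spin τ k := by
    intro τ k
    have := abs_lt.1 (ht k)
    rcases spin_eq_one_or τ k with h | h <;> rw [h] <;> linarith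
  -- Up to normalization, p is the logarithm of the Gibbs weight relative to the product measure;
  -- Jensen's inequality for exp is the Gibbs variational principle.
  set p : Spins N → ℝ := fun τ => 1 / 2 * β * energy J τ - ∑ k, Real.log (1 + t k * spin τ k)
    with hp
  have hjensen : Real.exp (∑ τ, productProb t τ • p τ)
      ≤ ∑ τ, productProb t τ • Real.exp (p τ) :=
    convexOn_exp.map_sum_le
      (fun τ _ => Finset.prod_nonneg fun k _ => (div_pos (hpos τ k) two_pos).le)
      (sum_productProb t) (fun _ _ => Set.mem_univ _)
  have hrhs : ∑ τ, productProb t τ • Real.exp (p τ) = Real.exp (logPartition J β) := by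
    rw [exp_logPartition, Finset.mul_sum]
    refine Finset.sum_congr rfl fun τ _ => ?_
    have h1 : Real.exp (∑ k, Real.log (1 + t k * spin τ k)) = ∏ k, (1 + t k * spin τ k) := by
      rw [Real.exp_sum]
      exact Finset.prod_congr rfl fun k _ => Real.exp_log (hpos τ k)
    have h2 : ∏ k, (1 + t k * spin τ k) ≠ 0 := (Finset.prod_pos fun k _ => hpos τ k).ne'
    rw [hp, Real.exp_sub, h1, productProb, Finset.prod_div_distrib, smul_eq_mul]
    simp only [Finset.prod_const, Finset.card_univ, Fintype.card_fin]
    field_simp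
  rw [hrhs, Real.exp_le_exp] at hjensen
  refine le_trans ?_ hjensen
  have henergy : ∑ τ, productProb t τ * energy J τ = ∑ i, ∑ j, J i j * t i * t j := by
    simp_rw [energy, Finset.mul_sum]
    rw [Finset.sum_comm]
    refine Finset.sum_congr rfl fun i _ => ?_
    rw [Finset.sum_comm]
    refine Finset.sum_congr rfl fun j _ => ?_
    -- On the diagonal the mean of σ_i² is 1 rather than t_i², so the zero diagonal of J is needed.
    by_cases hij : i = j
    · subst hij; simp [hJ]
    · rw [mul_assoc, ← sum_productProb_mul_pair t hij, Finset.mul_sum]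
      exact Finset.sum_congr rfl fun τ _ => by ring
  have hent : ∑ τ, productProb t τ * ∑ k, Real.log (1 + t k * spin τ k)
      ≤ ∑ i, (t i ^ 2 / 2 + t i ^ 4 / 3) := by
    simp_rw [Finset.mul_sum]
    rw [Finset.sum_comm]
    refine Finset.sum_le_sum fun i _ => ?_
    rw [sum_productProb_mul t i (fun x => Real.log (1 + t i * x))]
    have h := abs_lt.1 (ht i)
    have h1 := log_one_add_le (x := t i * 1) (by linarith)
    have h2 := log_one_add_le (x := t i * -1) (by linarith)
    have h3 := mul_le_mul_of_nonneg_left h1 (show 0 ≤ (1 + t i) / 2 by linarith)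
    have h4 := mul_le_mul_of_nonneg_left h2 (show 0 ≤ (1 - t i) / 2 by linarith)
    refine (add_le_add h3 h4).trans (le_of_eq ?_)
    ring
  have hsplit : ∑ τ, productProb t τ • p τ = 1 / 2 * β * ∑ τ, productProb t τ * energy J τ
      - ∑ τ, productProb t τ * ∑ k, Real.log (1 + t k * spin τ k) := by
    rw [Finset.mul_sum, ← Finset.sum_sub_distrib]
    refine Finset.sum_congr rfl fun τ _ => ?_
    simp only [hp, smul_eq_mul]; ring
  rw [hsplit, henergy]
  linarith

theorem logPartition_nonneg {N : ℕ} (J : Matrix (Fin N) (Fin N) ℝ) (hJ : ∀ i, J i i = 0)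
    (β : ℝ) : 0 ≤ logPartition J β := by
  simpa using le_logPartition J hJ β 0 (by simp)

/-! Flipping one spin -/

/-- The configuration with the spin at `i` flipped. -/
def flipSpin {N : ℕ} (i : Fin N) (τ : Spins N) : Spins N := Function.update τ i (-τ i)

theorem flipSpin_involutive {N : ℕ} (i : Fin N) :
    Function.Involutive (flipSpin i : Spins N → Spins N) := by
  intro τ
  simp [flipSpin]

theorem spin_flipSpin_self {N : ℕ} (i : Fin N) (τ : Spins N) :
    spin (flipSpin i τ) i = -spin τ i := by
  simp [spin, flipSpin]

theorem spin_flipSpin_of_ne {N : ℕ} {i j : Fin N} (h : j ≠ i) (τ : Spins N) :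
    spin (flipSpin i τ) j = spin τ j := by
  simp [spin, flipSpin, h]

theorem spin_flipSpin {N : ℕ} (i j : Fin N) (τ : Spins N) :
    spin (flipSpin i τ) j = spin τ j - if j = i then 2 * spin τ i else 0 := by
  split_ifs with h
  · subst h; rw [spin_flipSpin_self]; ring
  · rw [spin_flipSpin_of_ne h, sub_zero]

theorem localField_flipSpin {N : ℕ} (J : Matrix (Fin N) (Fin N) ℝ) (i j : Fin N)
    (τ : Spins N) :
    localField J (flipSpin i τ) j = localField J τ j - 2 * J j i * spin τ i := by
  simp only [localField, spin_flipSpin, mul_sub, Finset.sum_sub_distrib]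
  simp; ring

theorem energy_eq_sum_localField {N : ℕ} (J : Matrix (Fin N) (Fin N) ℝ) (τ : Spins N) :
    energy J τ = ∑ i, spin τ i * localField J τ i := by
  simp only [energy, localField, Finset.mul_sum]
  exact Finset.sum_congr rfl fun i _ => Finset.sum_congr rfl fun j _ => by ring

theorem energy_flipSpin {N : ℕ} (J : Matrix (Fin N) (Fin N) ℝ) (hJ : ∀ i, J i i = 0)
    (hs : ∀ i j, J i j = J j i) (i : Fin N) (τ : Spins N) :
    energy J (flipSpin i τ) = energy J τ - 4 * (spin τ i * localField J τ i) := by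
  simp only [energy_eq_sum_localField, localField_flipSpin, spin_flipSpin, sub_mul, mul_sub,
    Finset.sum_sub_distrib, ite_mul, zero_mul, Finset.sum_ite_eq', Finset.mem_univ, if_true, hJ]
  have : ∑ x, spin τ x * (2 * J x i * spin τ i) = 2 * (spin τ i * localField J τ i) := by
    simp only [localField, Finset.mul_sum]
    refine Finset.sum_congr rfl fun x _ => ?_
    rw [hs x i]; ring
  rw [this]; ring

/-- Conditionally on the other spins, the mean of `σ_i` is `tanh (β m_i)`. -/
theorem isingExp_sub_tanh_mul {N : ℕ} (J : Matrix (Fin N) (Fin N) ℝ) (hJ : ∀ i, J i i = 0)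
    (hs : ∀ i j, J i j = J j i) (β : ℝ) (i : Fin N) (h : Spins N → ℝ)
    (hh : ∀ τ, h (flipSpin i τ) = h τ) :
    isingExp J β (fun τ => (spin τ i - Real.tanh (β * localField J τ i)) * h τ) = 0 := by
  set f : Spins N → ℝ := fun τ => isingProb J β τ *
    ((spin τ i - Real.tanh (β * localField J τ i)) * h τ) with hf
  have h1 : ∑ τ, f (flipSpin i τ) = ∑ τ, f τ :=
    Equiv.sum_comp (flipSpin_involutive i).toPerm f
  -- The field m_i does not see σ_i, and the weights of τ and of its flip have ratio exp(2β σ_i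
  -- m_i); the two terms cancel.
  have h2 : ∀ τ, f τ + f (flipSpin i τ) = 0 := by
    intro τ
    simp only [hf, isingProb_eq, energy_flipSpin J hJ hs, localField_flipSpin, hJ, hh,
      spin_flipSpin_self]
    set x := β * localField J τ i with hx
    have e : 1 / 2 * β * (energy J τ - 4 * (spin τ i * localField J τ i))
        = 1 / 2 * β * energy J τ + (-(2 * (spin τ i * x))) := by rw [hx]; ring
    rw [e, Real.exp_add, show localField J τ i - 2 * 0 * spin τ i = localField J τ i by ring, ← hx]
    have key : (spin τ i - Real.tanh x) + Real.exp (-(2 * (spin τ i * x))) *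
        (-spin τ i - Real.tanh x) = 0 := by
      have hc : Real.exp x + Real.exp (-x) ≠ 0 := by positivity
      have e0 : Real.exp (-x) = (Real.exp x)⁻¹ := Real.exp_neg x
      rw [Real.tanh_eq]
      rcases spin_eq_one_or τ i with h | h <;> rw [h]
      · rw [show -(2 * (1 * x)) = -x + -x by ring, Real.exp_add]
        rw [e0] at hc ⊢
        have := Real.exp_ne_zero x
        field_simp
        ring
      · rw [show -(2 * (-1 * x)) = x + x by ring, Real.exp_add]
        rw [e0] at hc ⊢
        have := Real.exp_ne_zero x
        field_simp
        ring
    linear_combination (1 / 2 ^ N * Real.exp (-logPartition J β) *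
      Real.exp (1 / 2 * β * energy J τ) * h τ) * key
  have h3 : ∑ τ, f τ + ∑ τ, f (flipSpin i τ) = 0 := by
    rw [← Finset.sum_add_distrib]
    exact Finset.sum_eq_zero fun τ _ => h2 τ
  change ∑ τ, f τ = 0
  linarith

/-! The determinantal upper bound on the partition function -/

/-- The Schur complement of the top left entry of a matrix. -/
noncomputable def schurSucc {n : ℕ} (P : Matrix (Fin (n + 1)) (Fin (n + 1)) ℝ) :
    Matrix (Fin n) (Fin n) ℝ :=
  Matrix.of fun i j => P i.succ j.succ - P i.succ 0 * P 0 j.succ / P 0 0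

/-- Subtracting multiples of row 0 clears the first column below its top entry; expand along that
column. -/
theorem det_eq_mul_det_schurSucc {n : ℕ} (P : Matrix (Fin (n + 1)) (Fin (n + 1)) ℝ)
    (h : P 0 0 ≠ 0) : P.det = P 0 0 * (schurSucc P).det := by
  set c : Fin (n + 1) → ℝ := Fin.cons 0 fun i => P i.succ 0 / P 0 0 with hc
  set B : Matrix (Fin (n + 1)) (Fin (n + 1)) ℝ := Matrix.of fun i j => P i j - c i * P 0 j with hB
  have hdet : P.det = B.det := by
    refine Matrix.det_eq_of_forall_row_eq_smul_add_const c 0 (by simp [hc]) fun i j => ?_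
    simp [hB, hc]
  rw [hdet, Matrix.det_succ_column_zero, Fin.sum_univ_succ, Finset.sum_eq_zero, add_zero]
  · have : B.submatrix (Fin.succAbove 0) Fin.succ = schurSucc P := by
      ext i j
      simp [hB, hc, schurSucc]; ring
    rw [this]
    simp [hB, hc]
  · intro i _
    have : B i.succ 0 = 0 := by
      simp [hB, hc, h]
    simp [this]

/-- The form of the Schur complement at x is the form of P at the extension of x by the first
coordinate that minimizes it, namely -a / P 0 0. -/
theorem posDef_schurSucc {n : ℕ} {P : Matrix (Fin (n + 1)) (Fin (n + 1)) ℝ}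
    (hP : P.PosDef) : (schurSucc P).PosDef := by
  have h0 : 0 < P 0 0 := hP.diag_pos
  have hsym : ∀ i j, P i j = P j i := fun i j => by
    have := hP.isHermitian.apply j i
    simpa using this
  rw [Matrix.posDef_iff_dotProduct_mulVec]
  constructor
  · ext i j
    simp only [Matrix.conjTranspose_apply, schurSucc, Matrix.of_apply, star_trivial]
    rw [hsym j.succ i.succ, hsym j.succ 0, hsym i.succ 0]; ring
  · intro x hx
    set a : ℝ := ∑ j, P 0 j.succ * x j with ha
    set y : Fin (n + 1) → ℝ := Fin.cons (-a / P 0 0) x with hy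
    have hy0 : y ≠ 0 := by
      intro h
      apply hx
      ext i
      have := congrFun h i.succ
      simpa [hy] using this
    have hpos := hP.dotProduct_mulVec_pos hy0
    have e1 : star y ⬝ᵥ P.mulVec y = star x ⬝ᵥ (schurSucc P).mulVec x := by
      simp only [dotProduct, Matrix.mulVec, Pi.star_apply, star_trivial, Fin.sum_univ_succ, hy,
        Fin.cons_zero, Fin.cons_succ, schurSucc, Matrix.of_apply]
      rw [← ha]
      have e2 : ∀ i : Fin n, ∑ j : Fin n,
          (P i.succ j.succ - P i.succ 0 * P 0 j.succ / P 0 0) * x j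
          = ∑ j : Fin n, P i.succ j.succ * x j - P i.succ 0 * a / P 0 0 := by
        intro i
        rw [ha, Finset.mul_sum, Finset.sum_div, ← Finset.sum_sub_distrib]
        exact Finset.sum_congr rfl fun j _ => by ring
      simp_rw [e2]
      have e3 : P 0 0 * (-a / P 0 0) + a = 0 := by field_simp; ring
      rw [e3, mul_zero, zero_add]
      refine Finset.sum_congr rfl fun i _ => ?_
      ring
    rwa [e1] at hpos

theorem sum_spins_succ {n : ℕ} (f : Spins (n + 1) → ℝ) :
    ∑ τ, f τ = ∑ τ : Spins n, (f (Fin.cons 1 τ) + f (Fin.cons (-1) τ)) := by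
  rw [← (Fin.consEquiv fun _ : Fin (n + 1) => ℤˣ).sum_comp f, Fintype.sum_prod_type,
    show (Finset.univ : Finset ℤˣ) = {1, -1} from rfl, Finset.sum_pair (by decide),
    ← Finset.sum_add_distrib]
  rfl

theorem energy_cons {n : ℕ} (M : Matrix (Fin (n + 1)) (Fin (n + 1)) ℝ)
    (hs : ∀ i j, M i j = M j i) (s : ℤˣ) (τ : Spins n) :
    energy M (Fin.cons s τ : Spins (n + 1)) = M 0 0
      + 2 * (((s : ℤ) : ℝ) * ∑ j, M 0 j.succ * spin τ j)
      + energy (M.submatrix Fin.succ Fin.succ) τ := by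
  have hss : ((s : ℤ) : ℝ) * ((s : ℤ) : ℝ) = 1 := by
    rcases Int.units_eq_one_or s with h | h <;> simp [h]
  simp only [energy, Fin.sum_univ_succ, Matrix.submatrix_apply]
  simp only [spin, Fin.cons_zero, Fin.cons_succ, Finset.sum_add_distrib]
  have e1 : ∑ j : Fin n, M 0 j.succ * ((s : ℤ) : ℝ) * ((τ j : ℤ) : ℝ)
      = (s : ℤ) * ∑ j : Fin n, M 0 j.succ * ((τ j : ℤ) : ℝ) := by
    rw [Finset.mul_sum]; exact Finset.sum_congr rfl fun j _ => by ring
  have e2 : ∑ j : Fin n, M j.succ 0 * ((τ j : ℤ) : ℝ) * ((s : ℤ) : ℝ)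
      = (s : ℤ) * ∑ j : Fin n, M 0 j.succ * ((τ j : ℤ) : ℝ) := by
    rw [Finset.mul_sum]; exact Finset.sum_congr rfl fun j _ => by rw [hs j.succ 0]; ring
  rw [e1, e2, mul_assoc, hss]; ring

/-- Rademacher variables are dominated by Gaussian variables in the partition function of a
quadratic form. -/
theorem mean_exp_energy_le_det : ∀ (n : ℕ) (M : Matrix (Fin n) (Fin n) ℝ),
    (∀ i j, M i j = M j i) → (∀ i, 0 ≤ M i i) → (1 - M).PosDef →
    (1 / 2 ^ n) * ∑ τ : Spins n, Real.exp (1 / 2 * energy M τ) ≤ 1 / √(1 - M).det := by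
  intro n
  induction n with
  | zero => intro M _ _ _; simp [energy]
  -- The first spin is summed out. Its linear coupling b gives cosh b ≤ exp(b²/2) ≥ nothing more
  -- than exp(b²/(2a)) since a ≤ 1, and adding b²/a to the remaining form produces precisely the
  -- Schur complement of 1 - M. This creates nonnegative diagonal entries, which is why the
  -- induction cannot assume a zero diagonal.
  | succ n ih =>
    intro M hs hd hP
    set a : ℝ := 1 - M 0 0 with ha
    have ha0 : 0 < a := by
      have := hP.diag_pos (i := 0)
      simp only [Matrix.sub_apply, Matrix.one_apply_eq] at this
      exact this
    have ha1 : a ≤ 1 := by have := hd 0; linarith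
    have hPa : (1 - M) 0 0 = a := by simp [ha]
    set M' : Matrix (Fin n) (Fin n) ℝ := 1 - schurSucc (1 - M) with hM'
    have hM'ij : ∀ i j, M' i j = M i.succ j.succ + M 0 i.succ * M 0 j.succ / a := by
      intro i j
      simp only [hM', schurSucc, Matrix.sub_apply, Matrix.of_apply, Matrix.one_apply,
        Fin.succ_inj, ← ha, if_true, Fin.succ_ne_zero, (Fin.succ_ne_zero _).symm, if_false]
      rw [hs i.succ 0]; ring
    have key := ih M' (fun i j => by rw [hM'ij, hM'ij, hs i.succ]; ring)
      (fun i => by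
        rw [hM'ij]
        exact add_nonneg (hd _) (div_nonneg (mul_self_nonneg _) ha0.le))
      (by rw [hM', sub_sub_cancel]; exact posDef_schurSucc hP)
    have hdet : (1 - M).det = a * (1 - M').det := by
      rw [det_eq_mul_det_schurSucc _ (by rw [hPa]; exact ha0.ne'), hPa, hM', sub_sub_cancel]
    -- This is 1 - x ≤ exp(-x) at x = M 0 0, after a square root.
    have hexp : Real.exp (1 / 2 * M 0 0) ≤ 1 / √a := by
      rw [le_div_iff₀ (Real.sqrt_pos.2 ha0)]
      have h1 : √a ≤ Real.exp (-(1 / 2 * M 0 0)) := by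
        rw [Real.sqrt_le_left (Real.exp_pos _).le, ← Real.exp_nat_mul]
        have := Real.add_one_le_exp (-(M 0 0))
        refine le_trans (by rw [ha]; linarith) (this.trans (le_of_eq ?_))
        congr 1; push_cast; ring
      calc _ ≤ Real.exp (1 / 2 * M 0 0) * Real.exp (-(1 / 2 * M 0 0)) := by gcongr
        _ = 1 := by rw [← Real.exp_add]; simp
    have hterm : ∀ τ : Spins n,
        Real.exp (1 / 2 * energy M (Fin.cons 1 τ : Spins (n + 1)))
          + Real.exp (1 / 2 * energy M (Fin.cons (-1) τ : Spins (n + 1)))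
        ≤ 2 * (1 / √a) * Real.exp (1 / 2 * energy M' τ) := by
      intro τ
      set b : ℝ := ∑ j, M 0 j.succ * spin τ j with hb
      set E : ℝ := energy (M.submatrix Fin.succ Fin.succ) τ with hE
      have hE' : energy M' τ = E + b ^ 2 / a := by
        have : b ^ 2 / a = ∑ i, ∑ j,
            M 0 (Fin.succ i) * M 0 (Fin.succ j) / a * spin τ i * spin τ j := by
          rw [hb, sq, Finset.sum_mul_sum, Finset.sum_div]
          refine Finset.sum_congr rfl fun i _ => ?_
          rw [Finset.sum_div]
          exact Finset.sum_congr rfl fun j _ => by ring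
        rw [this, hE]
        simp only [energy, hM'ij, add_mul, Finset.sum_add_distrib, Matrix.submatrix_apply]
      rw [energy_cons M hs, energy_cons M hs, hE', ← hb, ← hE]
      have h1 : Real.exp (1 / 2 * (M 0 0 + 2 * (((1 : ℤˣ) : ℤ) * b) + E))
          + Real.exp (1 / 2 * (M 0 0 + 2 * (((-1 : ℤˣ) : ℤ) * b) + E))
          = 2 * (Real.exp (1 / 2 * M 0 0) * (Real.cosh b * Real.exp (1 / 2 * E))) := by
        have e1 : 1 / 2 * (M 0 0 + 2 * (((1 : ℤˣ) : ℤ) * b) + E)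
            = 1 / 2 * M 0 0 + (b + 1 / 2 * E) := by push_cast; ring
        have e2 : 1 / 2 * (M 0 0 + 2 * (((-1 : ℤˣ) : ℤ) * b) + E)
            = 1 / 2 * M 0 0 + (-b + 1 / 2 * E) := by push_cast; ring
        rw [e1, e2, Real.cosh_eq]
        simp only [Real.exp_add]
        ring
      rw [h1, mul_assoc]
      have h2 : Real.cosh b * Real.exp (1 / 2 * E) ≤ Real.exp (1 / 2 * (E + b ^ 2 / a)) := by
        have h3 : b ^ 2 / 2 ≤ 1 / 2 * (b ^ 2 / a) := by
          have : b ^ 2 ≤ b ^ 2 / a := le_div_self (sq_nonneg b) ha0 ha1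
          linarith
        calc _ ≤ Real.exp (b ^ 2 / 2) * Real.exp (1 / 2 * E) := by
              gcongr; exact Real.cosh_le_exp_half_sq b
          _ = Real.exp (b ^ 2 / 2 + 1 / 2 * E) := (Real.exp_add _ _).symm
          _ ≤ _ := Real.exp_le_exp.2 (by linarith)
      have := Real.cosh_pos b
      gcongr
    rw [sum_spins_succ]
    calc (1 / 2 ^ (n + 1) : ℝ) * _
        ≤ (1 / 2 ^ (n + 1)) * ∑ τ : Spins n, 2 * (1 / √a) * Real.exp (1 / 2 * energy M' τ) := by
          gcongr with τ
          exact hterm τ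
      _ = (1 / √a) * ((1 / 2 ^ n) * ∑ τ : Spins n, Real.exp (1 / 2 * energy M' τ)) := by
          rw [← Finset.mul_sum, pow_succ]; field_simp
      _ ≤ (1 / √a) * (1 / √(1 - M').det) := by gcongr
      _ = _ := by rw [hdet, Real.sqrt_mul ha0.le, one_div_mul_one_div]

theorem trace_mul_self_eq_sum_eigenvalues_sq {n : ℕ} {A : Matrix (Fin n) (Fin n) ℝ}
    (hA : A.IsHermitian) : (A * A).trace = ∑ i, hA.eigenvalues i ^ 2 := by
  conv_lhs => rw [hA.spectral_theorem]
  rw [← map_mul, Unitary.conjStarAlgAut_apply, Matrix.trace_mul_cycle,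
    Unitary.coe_star_mul_self, one_mul, Matrix.diagonal_mul_diagonal, Matrix.trace_diagonal]
  exact Finset.sum_congr rfl fun i _ => by simp [sq]

/-- From log(1/p) ≤ 1/p - 1. The linear term is kept apart because it sums to zero over the
eigenvalues of 1 - βJ. -/
theorem neg_log_le_of_le {p δ : ℝ} (hδ : 0 < δ) (hp : δ ≤ p) :
    -Real.log p ≤ (1 - p) + (1 - p) ^ 2 / δ := by
  have hp0 : 0 < p := hδ.trans_le hp
  have h1 := Real.log_le_sub_one_of_pos (inv_pos.2 hp0)
  rw [Real.log_inv] at h1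
  have h2 : p⁻¹ - 1 = (1 - p) + (1 - p) ^ 2 / p := by field_simp; ring
  have h3 : (1 - p) ^ 2 / p ≤ (1 - p) ^ 2 / δ := by gcongr
  linarith

/-- In the subcritical regime the log-partition function is bounded. -/
theorem logPartition_le {N : ℕ} (J : Matrix (Fin N) (Fin N) ℝ) (hJ : ∀ i, J i i = 0)
    (hs : ∀ i j, J i j = J j i) (hJ2 : ∑ i, ∑ j, J i j ^ 2 ≤ 1) {β δ : ℝ} (hβ : 0 < β)
    (hδ : 0 < δ) (hspec : ∀ (l : ℝ) (v : Fin N → ℝ), v ≠ 0 → J.mulVec v = l • v → β * l ≤ 1 - δ) :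
    logPartition J β ≤ β ^ 2 / (2 * δ) := by
  set P : Matrix (Fin N) (Fin N) ℝ := 1 - β • J with hPdef
  have hP : P.IsHermitian := by
    ext i j
    simp [hPdef, Matrix.one_apply, hs j i, eq_comm]
  have heig : ∀ i, δ ≤ hP.eigenvalues i := by
    intro i
    have h1 := hP.mulVec_eigenvectorBasis i
    have hne : (hP.eigenvectorBasis i).ofLp ≠ 0 :=
      (WithLp.ofLp_eq_zero 2).ne.2 <| hP.eigenvectorBasis.orthonormal.ne_zero i
    set v : Fin N → ℝ := (hP.eigenvectorBasis i).ofLp with hv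
    have hmv : P.mulVec v = v - β • J.mulVec v := by
      rw [hPdef, Matrix.sub_mulVec, Matrix.one_mulVec, Matrix.smul_mulVec]
    rw [hmv] at h1
    -- An eigenvector of 1 - βJ for λ is an eigenvector of J for (1 - λ)/β.
    have h2 := hspec ((1 - hP.eigenvalues i) / β) v hne (by
      ext k
      have := congrFun h1 k
      simp only [Pi.sub_apply, Pi.smul_apply, smul_eq_mul] at this ⊢
      field_simp
      linarith)
    rw [mul_div_cancel₀ _ hβ.ne'] at h2
    linarith
  have hpos : P.PosDef := hP.posDef_iff_eigenvalues_pos.2 fun i => hδ.trans_le (heig i)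
  have hdet : P.det = ∏ i, hP.eigenvalues i := by
    simpa using hP.det_eq_prod_eigenvalues
  have htr : ∑ i, hP.eigenvalues i = N := by
    have h := hP.trace_eq_sum_eigenvalues
    simp only [RCLike.ofReal_real_eq_id, id] at h
    rw [← h]
    simp [hPdef, Matrix.trace, hJ]
  have htr2 : ∑ i, (1 - hP.eigenvalues i) ^ 2 ≤ β ^ 2 := by
    have h := trace_mul_self_eq_sum_eigenvalues_sq hP
    have h1 : (P * P).trace = N + β ^ 2 * ∑ i, ∑ j, J i j ^ 2 := by
      have e : P * P = 1 - (2 * β) • J + (β ^ 2) • (J * J) := by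
        simp only [hPdef, sub_mul, mul_sub, one_mul, mul_one, smul_mul_smul_comm, sq, two_mul,
          add_smul]
        abel
      rw [e, Matrix.trace_add, Matrix.trace_sub, Matrix.trace_smul, Matrix.trace_smul]
      have e1 : J.trace = 0 := by simp [Matrix.trace, hJ]
      have e2 : (J * J).trace = ∑ i, ∑ j, J i j ^ 2 := by
        simp only [Matrix.trace, Matrix.diag_apply, Matrix.mul_apply]
        exact Finset.sum_congr rfl fun i _ => Finset.sum_congr rfl fun j _ => by
          rw [hs j i, sq]
      rw [e1, e2]; simp
    have h2 : ∑ i, (1 - hP.eigenvalues i) ^ 2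
        = N - 2 * ∑ i, hP.eigenvalues i + ∑ i, hP.eigenvalues i ^ 2 := by
      simp only [sub_sq, one_pow, mul_one, Finset.sum_add_distrib, Finset.sum_sub_distrib,
        ← Finset.mul_sum]
      simp
    rw [h2, ← h, h1, htr]
    nlinarith [sq_nonneg β]
  have hlog : -Real.log P.det ≤ β ^ 2 / δ := by
    rw [hdet, Real.log_prod fun i _ => (hδ.trans_le (heig i)).ne', ← Finset.sum_neg_distrib]
    calc ∑ i, -Real.log (hP.eigenvalues i)
        ≤ ∑ i, ((1 - hP.eigenvalues i) + (1 - hP.eigenvalues i) ^ 2 / δ) :=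
          Finset.sum_le_sum fun i _ => neg_log_le_of_le hδ (heig i)
      _ = (∑ i, (1 - hP.eigenvalues i) ^ 2) / δ := by
          rw [Finset.sum_add_distrib, Finset.sum_sub_distrib, htr, ← Finset.sum_div]; simp
      _ ≤ β ^ 2 / δ := by gcongr
  have hmain := mean_exp_energy_le_det N (β • J) (fun i j => by simp [hs i j])
    (fun i => by simp [hJ]) hpos
  have hen : ∀ τ : Spins N, 1 / 2 * energy (β • J) τ = 1 / 2 * β * energy J τ := by
    intro τ
    rw [mul_assoc]
    simp only [energy, Matrix.smul_apply, smul_eq_mul, Finset.mul_sum, mul_assoc]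
  simp_rw [hen] at hmain
  rw [← exp_logPartition, ← hPdef] at hmain
  have h3 : 1 / √P.det = Real.exp (-Real.log P.det / 2) := by
    rw [neg_div, Real.exp_neg, one_div, ← Real.log_sqrt hpos.det_pos.le,
      Real.exp_log (Real.sqrt_pos.2 hpos.det_pos)]
  rw [h3, Real.exp_le_exp] at hmain
  refine hmain.trans ?_
  have : β ^ 2 / (2 * δ) = β ^ 2 / δ / 2 := by field_simp
  rw [this]
  linarith

/-! Bilinear forms of kernels -/

/-- The bilinear form `∫∫ U(x, y) f(x) g(y) dx dy`. -/
noncomputable def kernelForm (U : I → I → ℝ) (f g : I → ℝ) : ℝ :=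
  ∫ p : I × I, U p.1 p.2 * (f p.1 * g p.2)

theorem integrable_kernelForm_of_integrable {U : I → I → ℝ}
    (hU : Measurable (Function.uncurry U)) {C : ℝ} (hUC : ∀ x y, |U x y| ≤ C) {f g : I → ℝ}
    (hf : Integrable f) (hg : Integrable g) :
    Integrable (fun p : I × I => U p.1 p.2 * (f p.1 * g p.2)) :=
  (hf.mul_prod hg).bdd_mul (c := C) hU.aestronglyMeasurable
    (Eventually.of_forall fun p => hUC p.1 p.2)

theorem kernelForm_eq_integral_integral {U : I → I → ℝ}
    (hU : Measurable (Function.uncurry U)) {C : ℝ} (hUC : ∀ x y, |U x y| ≤ C) {f g : I → ℝ}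
    (hf : Integrable f) (hg : Integrable g) :
    kernelForm U f g = ∫ x, f x * ∫ y, U x y * g y := by
  rw [kernelForm, Measure.volume_eq_prod,
    integral_prod _ (integrable_kernelForm_of_integrable hU hUC hf hg)]
  refine integral_congr_ae (Eventually.of_forall fun x => ?_)
  simp only
  rw [← integral_const_mul]
  exact integral_congr_ae (Eventually.of_forall fun y => by ring)

theorem kernelForm_swap (U : I → I → ℝ) (f g : I → ℝ) :
    kernelForm U f g = kernelForm (fun x y => U y x) g f := by
  rw [kernelForm, kernelForm, Measure.volume_eq_prod, ← integral_prod_swap]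
  refine integral_congr_ae (Eventually.of_forall fun p => ?_)
  simp only [Prod.fst_swap, Prod.snd_swap]
  ring

theorem kernelForm_congr_ae (U : I → I → ℝ) {f f' g g' : I → ℝ} (hf : f =ᵐ[volume] f')
    (hg : g =ᵐ[volume] g') : kernelForm U f g = kernelForm U f' g' := by
  refine integral_congr_ae ?_
  rw [Measure.volume_eq_prod]
  filter_upwards [Measure.quasiMeasurePreserving_fst.ae_eq_comp hf,
    Measure.quasiMeasurePreserving_snd.ae_eq_comp hg] with p h1 h2
  simp only [Function.comp_apply] at h1 h2
  rw [h1, h2]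

theorem integrable_of_measurable_of_abs_le {f : I → ℝ} (hf : Measurable f) {B : ℝ}
    (hB : ∀ x, |f x| ≤ B) : Integrable f :=
  Integrable.of_bound hf.aestronglyMeasurable B (Eventually.of_forall hB)

/-- Among functions bounded by B, the extremal one is B times the sign of h, a difference of two
indicators. -/
theorem abs_integral_mul_le {f h : I → ℝ} (hh : Measurable h) (hhi : Integrable h) {B : ℝ}
    (hB : ∀ x, |f x| ≤ B) :
    |∫ x, f x * h x| ≤ B * ((∫ x, ({x | 0 ≤ h x}.indicator 1 : I → ℝ) x * h x)
      - ∫ x, ({x | 0 ≤ h x}ᶜ.indicator 1 : I → ℝ) x * h x) := by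
  have hS : MeasurableSet {x | 0 ≤ h x} := measurableSet_le measurable_const hh
  have e : ∀ S : Set I, MeasurableSet S → Integrable fun x => (S.indicator 1 : I → ℝ) x * h x := by
    intro S hS
    refine (hhi.indicator hS).congr (Eventually.of_forall fun x => ?_)
    by_cases hx : x ∈ S <;> simp [hx]
  rw [← integral_sub (e _ hS) (e _ hS.compl), ← integral_const_mul, ← Real.norm_eq_abs]
  refine norm_integral_le_of_norm_le ((((e _ hS).sub (e _ hS.compl)).const_mul B))
    (Eventually.of_forall fun x => ?_)
  rw [norm_mul, Real.norm_eq_abs, Real.norm_eq_abs]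
  refine mul_le_mul (hB x) ?_ (abs_nonneg _) ((abs_nonneg _).trans (hB x))
  by_cases hx : 0 ≤ h x
  · simp [hx, abs_of_nonneg hx]
  · simp [hx, abs_of_neg (not_le.1 hx)]

theorem exists_measurableSet_abs_kernelForm_le {U : I → I → ℝ}
    (hU : Measurable (Function.uncurry U)) {C : ℝ} (hUC : ∀ x y, |U x y| ≤ C) {f g : I → ℝ}
    (hf : Measurable f) {B : ℝ} (hB : ∀ x, |f x| ≤ B) (hg : Measurable g) {B' : ℝ}
    (hB' : ∀ x, |g x| ≤ B') :
    ∃ S : Set I, MeasurableSet S ∧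
      |kernelForm U f g| ≤ B * (|kernelForm U (S.indicator 1) g|
        + |kernelForm U (Sᶜ.indicator 1) g|) := by
  have hfi := integrable_of_measurable_of_abs_le hf hB
  have hgi := integrable_of_measurable_of_abs_le hg hB'
  set h : I → ℝ := fun x => ∫ y, U x y * g y with hh
  have hsm : StronglyMeasurable (fun p : I × I => U p.1 p.2 * g p.2) :=
    (hU.mul (hg.comp measurable_snd)).stronglyMeasurable
  have hhm : Measurable h := hsm.integral_prod_right.measurable
  have hUg : Integrable (fun p : I × I => U p.1 p.2 * g p.2) := by
    have := integrable_kernelForm_of_integrable hU hUC (integrable_const (1 : ℝ)) hgi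
    simpa using this
  have hhi : Integrable h := by
    rw [Measure.volume_eq_prod] at hUg
    exact hUg.integral_prod_left
  have hS : MeasurableSet {x | 0 ≤ h x} := measurableSet_le measurable_const hhm
  refine ⟨{x | 0 ≤ h x}, hS, ?_⟩
  have e : ∀ S : Set I, MeasurableSet S → Integrable (S.indicator 1 : I → ℝ) := fun S hS =>
    (integrable_const (1 : ℝ)).indicator hS
  rw [kernelForm_eq_integral_integral hU hUC hfi hgi,
    kernelForm_eq_integral_integral hU hUC (e _ hS) hgi,
    kernelForm_eq_integral_integral hU hUC (e _ hS.compl) hgi]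
  refine (abs_integral_mul_le hhm hhi hB).trans ?_
  have hB0 : 0 ≤ B := (abs_nonneg _).trans (hB 0)
  refine mul_le_mul_of_nonneg_left ?_ hB0
  refine (le_abs_self _).trans (abs_sub _ _)

/-- Needed because the real supremum of an unbounded set is 0 by convention. -/
theorem bddAbove_cutNorm {U : I → I → ℝ} {C : ℝ} (hUC : ∀ x y, |U x y| ≤ C) :
    BddAbove {r : ℝ | ∃ S T : Set I, MeasurableSet S ∧ MeasurableSet T ∧
      r = |∫ p in S ×ˢ T, U p.1 p.2|} := by
  have hC : 0 ≤ C := (abs_nonneg _).trans (hUC 0 0)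
  refine ⟨C, ?_⟩
  rintro r ⟨S, T, -, -, rfl⟩
  have h := norm_setIntegral_le_of_norm_le_const (μ := (volume : Measure (I × I)))
    (s := S ×ˢ T) (C := C) (f := fun p => U p.1 p.2) (measure_lt_top _ _)
    (fun p _ => hUC p.1 p.2)
  refine h.trans (mul_le_of_le_one_right hC ?_)
  exact measureReal_le_one

theorem abs_kernelForm_indicator_le_cutNorm {U : I → I → ℝ} {C : ℝ}
    (hUC : ∀ x y, |U x y| ≤ C) {S T : Set I} (hS : MeasurableSet S) (hT : MeasurableSet T) :
    |kernelForm U (S.indicator 1) (T.indicator 1)| ≤ cutNorm U := by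
  refine le_csSup (bddAbove_cutNorm hUC) ⟨S, T, hS, hT, ?_⟩
  rw [← integral_indicator (hS.prod hT), kernelForm]
  congr 1
  refine integral_congr_ae (Eventually.of_forall fun p => ?_)
  by_cases h1 : p.1 ∈ S <;> by_cases h2 : p.2 ∈ T <;> simp [Set.indicator, h1, h2]

/-- The form is linear in each argument, so each can be replaced by ±B on a set and its complement;
every replacement costs a factor 2B. -/
theorem abs_kernelForm_le_cutNorm {U : I → I → ℝ}
    (hU : Measurable (Function.uncurry U)) {C : ℝ} (hUC : ∀ x y, |U x y| ≤ C) {f g : I → ℝ}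
    (hf : Measurable f) {B : ℝ} (hB : ∀ x, |f x| ≤ B) (hg : Measurable g)
    (hB' : ∀ x, |g x| ≤ B) :
    |kernelForm U f g| ≤ 4 * B ^ 2 * cutNorm U := by
  have hB0 : 0 ≤ B := (abs_nonneg _).trans (hB 0)
  have hU' : Measurable (Function.uncurry fun x y => U y x) := hU.comp measurable_swap
  have key : ∀ S : Set I, MeasurableSet S →
      |kernelForm U (S.indicator 1) g| ≤ 2 * B * cutNorm U := by
    intro S hS
    have hm : Measurable (S.indicator 1 : I → ℝ) := measurable_one.indicator hS
    obtain ⟨T, hT, h⟩ := exists_measurableSet_abs_kernelForm_le hU' (fun x y => hUC y x) hg hB'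
      hm (B' := 1) (fun x => by by_cases hx : x ∈ S <;> simp [hx])
    rw [kernelForm_swap]
    refine h.trans ?_
    rw [kernelForm_swap _ (T.indicator 1), kernelForm_swap _ (Tᶜ.indicator 1)]
    have h1 := abs_kernelForm_indicator_le_cutNorm hUC hS hT
    have h2 := abs_kernelForm_indicator_le_cutNorm hUC hS hT.compl
    nlinarith
  obtain ⟨S, hS, h⟩ := exists_measurableSet_abs_kernelForm_le hU hUC hf hB hg hB'
  have h1 := key S hS
  have h2 := key Sᶜ hS.compl
  refine h.trans ?_
  nlinarith

/-! The norm of a graphon through its quadratic form -/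

theorem Graphon.abs_le_one (W : Graphon) (x y : I) : |W.toFun x y| ≤ 1 := by
  rw [abs_of_nonneg (W.nonneg' x y)]; exact W.le_one' x y

theorem inner_graphonOp (W : Graphon) (f g : Lp ℝ 2 (volume : Measure I)) :
    inner ℝ f (graphonOp W g) = kernelForm W.toFun f g := by
  rw [kernelForm_eq_integral_integral W.measurable' W.abs_le_one (integrable_of_L2 f)
    (integrable_of_L2 g), L2.inner_def]
  refine integral_congr_ae ?_
  have h : (graphonOp W g : I → ℝ) =ᵐ[volume] kernelFun W g := (memLp_kernelFun W g).coeFn_toLp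
  filter_upwards [h] with x hx
  rw [hx]
  simp [kernelFun, mul_comm]

theorem isSymmetric_graphonOp (W : Graphon) :
    (graphonOp W : Lp ℝ 2 (volume : Measure I) →ₗ[ℝ] Lp ℝ 2 (volume : Measure I)).IsSymmetric := by
  intro f g
  have h := inner_graphonOp W f g
  have h' := inner_graphonOp W g f
  simp only [ContinuousLinearMap.coe_coe]
  rw [h, real_inner_comm, h', kernelForm_swap]
  congr 1
  ext x y
  exact W.symm' y x

theorem norm_toLp_sq {f : I → ℝ} (hf : MemLp f 2 volume) :
    ‖hf.toLp f‖ ^ 2 = ∫ x, f x ^ 2 := by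
  rw [← real_inner_self_eq_norm_sq, L2.inner_def]
  refine integral_congr_ae ?_
  filter_upwards [hf.coeFn_toLp] with x hx
  rw [hx]; simp [sq]

theorem kernelForm_le_graphonNorm (W : Graphon) {f : I → ℝ} (hf : Measurable f) {B : ℝ}
    (hB : ∀ x, |f x| ≤ B) :
    kernelForm W.toFun f f ≤ graphonNorm W * ∫ x, f x ^ 2 := by
  have hm : MemLp f 2 volume := MemLp.of_bound hf.aestronglyMeasurable B (Eventually.of_forall hB)
  rw [← norm_toLp_sq hm, ← kernelForm_congr_ae W.toFun hm.coeFn_toLp hm.coeFn_toLp,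
    ← inner_graphonOp]
  refine (real_inner_le_norm _ _).trans ?_
  have := (graphonOp W).le_opNorm (hm.toLp f)
  rw [graphonNorm]
  have h0 := norm_nonneg (hm.toLp f)
  nlinarith

theorem graphonNorm_pos (W : Graphon) (hW : 0 < ∫ p : I × I, W.toFun p.1 p.2) :
    0 < graphonNorm W := by
  have h := kernelForm_le_graphonNorm W (f := fun _ => 1) measurable_const (B := 1) (by simp)
  simp [kernelForm] at h
  linarith

/-- `graphonOp W` is self-adjoint, so its norm is the supremum of absolute Rayleigh quotients. The
strict inequality is an open condition, hence holds at a simple function, and replacing that by its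
absolute value only helps since W ≥ 0. -/
theorem exists_lt_kernelForm (W : Graphon) {c : ℝ} (hc : 0 ≤ c) (hcW : c < graphonNorm W) :
    ∃ f : I → ℝ, Measurable f ∧ (∃ B, ∀ x, |f x| ≤ B) ∧
      c * ∫ x, f x ^ 2 < kernelForm W.toFun f f := by
  rw [graphonNorm, (graphonOp W).norm_eq_iSup_rayleighQuotient (isSymmetric_graphonOp W)] at hcW
  obtain ⟨v, hv⟩ := exists_lt_of_lt_ciSup hcW
  have hv' : c * ‖v‖ ^ 2 < |inner ℝ (graphonOp W v) v| := by
    have hv0 : 0 < ‖v‖ ^ 2 := by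
      -- The quotient at 0 is 0 by convention, which 0 ≤ c excludes.
      rcases eq_or_ne v 0 with h | h
      · subst h
        simp [ContinuousLinearMap.rayleighQuotient, ContinuousLinearMap.reApplyInnerSelf] at hv
        linarith
      · have := norm_pos_iff.2 h
        positivity
    rw [ContinuousLinearMap.rayleighQuotient, abs_div, abs_of_pos hv0, lt_div_iff₀ hv0,
      ContinuousLinearMap.reApplyInnerSelf] at hv
    simpa using hv
  have hopen : IsOpen {v : Lp ℝ 2 (volume : Measure I) |
      c * ‖v‖ ^ 2 < |inner ℝ (graphonOp W v) v|} :=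
    isOpen_lt (by fun_prop) (by fun_prop)
  obtain ⟨w, hw, hws⟩ := (Lp.simpleFunc.dense (E := ℝ) (μ := (volume : Measure I)) (p := 2)
    (by norm_num)).exists_mem_open hopen ⟨v, hv'⟩
  set s := Lp.simpleFunc.toSimpleFunc (⟨w, hw⟩ : Lp.simpleFunc ℝ 2 (volume : Measure I)) with hs
  have hsae : s =ᵐ[volume] w := Lp.simpleFunc.toSimpleFunc_eq_toFun _
  obtain ⟨B, hB⟩ := s.exists_forall_norm_le
  have hB' : ∀ x, |(|s x|)| ≤ B := fun x => by simpa using hB x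
  have hm : Measurable fun x => |s x| := s.measurable.abs
  refine ⟨fun x => |s x|, hm, ⟨B, hB'⟩, ?_⟩
  have h1 : ‖w‖ ^ 2 = ∫ x, |s x| ^ 2 := by
    rw [← real_inner_self_eq_norm_sq, L2.inner_def]
    refine integral_congr_ae ?_
    filter_upwards [hsae] with x hx
    rw [← hx]; simp [sq]
  have h2 : |inner ℝ (graphonOp W w) w| ≤ kernelForm W.toFun (fun x => |s x|) fun x => |s x| := by
    rw [real_inner_comm, inner_graphonOp, ← kernelForm_congr_ae W.toFun hsae hsae, kernelForm,
      kernelForm, ← Real.norm_eq_abs]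
    refine norm_integral_le_of_norm_le
      (integrable_kernelForm_of_integrable W.measurable' W.abs_le_one
        (integrable_of_measurable_of_abs_le hm hB') (integrable_of_measurable_of_abs_le hm hB'))
      (Eventually.of_forall fun p => ?_)
    rw [Real.norm_eq_abs, abs_mul, abs_mul, abs_of_nonneg (W.nonneg' _ _)]
  rw [← h1]
  exact lt_of_lt_of_le hws h2

/-- Relabelling a kernel by a measure-preserving map. -/
theorem kernelForm_comp (U : I → I → ℝ) (f g : I → ℝ) (φ : I ≃ᵐ I)
    (hφ : MeasurePreserving φ) :
    kernelForm (fun x y => U (φ x) (φ y)) (f ∘ φ) (g ∘ φ) = kernelForm U f g := by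
  have h : MeasurePreserving (Prod.map φ φ) (volume : Measure (I × I)) volume := hφ.prod hφ
  have := h.integral_comp (φ.prodCongr φ).measurableEmbedding
    (fun p : I × I => U p.1 p.2 * (f p.1 * g p.2))
  exact this

/-! The coupling matrix -/

open scoped Classical in
theorem coupling_apply {N : ℕ} (G : SimpleGraph (Fin N)) (i j : Fin N) :
    coupling G i j = if G.Adj i j then 1 / (N : ℝ) else 0 := by
  simp [coupling, SimpleGraph.adjMatrix_apply]

theorem coupling_self {N : ℕ} (G : SimpleGraph (Fin N)) (i : Fin N) : coupling G i i = 0 := by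
  simp [coupling_apply]

theorem coupling_comm {N : ℕ} (G : SimpleGraph (Fin N)) (i j : Fin N) :
    coupling G i j = coupling G j i := by
  by_cases h : G.Adj i j
  · simp [coupling_apply, h, h.symm]
  · simp [coupling_apply, h, show ¬ G.Adj j i from fun h' => h h'.symm]

theorem coupling_nonneg {N : ℕ} (G : SimpleGraph (Fin N)) (i j : Fin N) :
    0 ≤ coupling G i j := by
  rw [coupling_apply]; split_ifs <;> positivity

theorem coupling_le {N : ℕ} (G : SimpleGraph (Fin N)) (i j : Fin N) :
    coupling G i j ≤ 1 / N := by
  rw [coupling_apply]; split_ifs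
  · exact le_rfl
  · positivity

theorem sum_coupling_sq_le {N : ℕ} (G : SimpleGraph (Fin N)) :
    ∑ i, ∑ j, coupling G i j ^ 2 ≤ 1 := by
  calc ∑ i, ∑ j, coupling G i j ^ 2 ≤ ∑ _i : Fin N, ∑ _j : Fin N, (1 / (N : ℝ)) ^ 2 := by
        refine Finset.sum_le_sum fun i _ => Finset.sum_le_sum fun j _ => ?_
        exact pow_le_pow_left₀ (coupling_nonneg G i j) (coupling_le G i j) 2
    _ ≤ 1 := by
        simp only [Finset.sum_const, Finset.card_univ, Fintype.card_fin, nsmul_eq_mul]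
        rcases Nat.eq_zero_or_pos N with h | h
        · subst h; simp
        · have : (N : ℝ) ≠ 0 := by positivity
          field_simp; rfl

/-! Cells of the uniform partition -/

/-- The `i`-th cell of the partition of `[0, 1]` into `N` intervals. -/
def cell {N : ℕ} (i : Fin N) : Set I := {x | ⌈(N : ℝ) * (x : ℝ)⌉₊ = (i : ℕ) + 1}

theorem measurableSet_cell {N : ℕ} (i : Fin N) : MeasurableSet (cell i) :=
  measurableSet_eq_fun
    (Nat.measurable_ceil.comp ((measurable_subtype_coe).const_mul _)) measurable_const

theorem eq_of_mem_cell {N : ℕ} {i j : Fin N} {x : I} (hi : x ∈ cell i) (hj : x ∈ cell j) :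
    i = j := by
  simp only [cell, Set.mem_ofPred_eq] at hi hj
  ext; omega

theorem cell_eq_Ioc {N : ℕ} (i : Fin N) : ∃ a b : I, (b : ℝ) - a = 1 / N ∧
    cell i = Set.Ioc a b := by
  have hN : (0 : ℝ) < N := by exact_mod_cast i.pos
  have hi : ((i : ℕ) : ℝ) + 1 ≤ N := by exact_mod_cast i.isLt
  have h0 : (0 : ℝ) ≤ (i : ℕ) := by positivity
  refine ⟨⟨(i : ℕ) / N, by positivity, by rw [div_le_one hN]; linarith⟩,
    ⟨((i : ℕ) + 1) / N, by positivity, by rw [div_le_one hN]; linarith⟩, ?_, ?_⟩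
  · simp only; field_simp; ring
  · ext x
    simp only [cell, Set.mem_ofPred_eq, Set.mem_Ioc, ← Subtype.coe_lt_coe, ← Subtype.coe_le_coe]
    rw [Nat.ceil_eq_iff (by omega), div_lt_iff₀ hN, le_div_iff₀ hN]
    push_cast
    simp [mul_comm]

theorem volume_real_cell {N : ℕ} (i : Fin N) : volume.real (cell i) = 1 / N := by
  obtain ⟨a, b, hab, h⟩ := cell_eq_Ioc i
  rw [h, measureReal_def, unitInterval.volume_Ioc, hab, ENNReal.toReal_ofReal (by positivity)]

theorem stepFun_eq_sum {N : ℕ} (G : SimpleGraph (Fin N)) (x y : I) :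
    stepFun G x y = N * ∑ i, ∑ j, coupling G i j *
      (((cell i).indicator 1 : I → ℝ) x * ((cell j).indicator 1 : I → ℝ) y) := by
  classical
  -- The cells are half-open on the left: for N > 0 only x = 0 lies in none of them.
  by_cases hx : ∃ i : Fin N, x ∈ cell i
  swap
  · rw [Finset.sum_eq_zero, mul_zero, stepFun, if_neg]
    · rintro ⟨i, j, -, h, -⟩; exact hx ⟨i, h⟩
    · intro i _
      simp [Set.indicator_of_notMem fun h => hx ⟨i, h⟩]
  by_cases hy : ∃ i : Fin N, y ∈ cell i
  swap
  · rw [Finset.sum_eq_zero, mul_zero, stepFun, if_neg]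
    · rintro ⟨i, j, -, -, h⟩; exact hy ⟨j, h⟩
    · intro i _
      refine Finset.sum_eq_zero fun j _ => ?_
      simp [Set.indicator_of_notMem fun h => hy ⟨j, h⟩]
  obtain ⟨i, hi⟩ := hx
  obtain ⟨j, hj⟩ := hy
  have hN : (N : ℝ) ≠ 0 := by exact_mod_cast i.pos.ne'
  rw [Finset.sum_eq_single i, Finset.sum_eq_single j, coupling_apply]
  · simp only [Set.indicator_of_mem hi, Set.indicator_of_mem hj, Pi.one_apply, mul_one]
    rw [stepFun]
    have : (∃ i j : Fin N, G.Adj i j ∧ ⌈(N : ℝ) * (x : ℝ)⌉₊ = (i : ℕ) + 1 ∧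
        ⌈(N : ℝ) * (y : ℝ)⌉₊ = (j : ℕ) + 1) ↔ G.Adj i j := by
      constructor
      · rintro ⟨i', j', h, h1, h2⟩
        rwa [eq_of_mem_cell hi h1, eq_of_mem_cell hj h2]
      · exact fun h => ⟨i, j, h, hi, hj⟩
    simp only [this]
    split_ifs
    · field_simp
    · simp
  · intro j' _ hne
    have : y ∉ cell j' := fun h => hne (eq_of_mem_cell h hj)
    simp [this]
  · simp
  · intro i' _ hne
    have : x ∉ cell i' := fun h => hne (eq_of_mem_cell h hi)
    simp [this]
  · simp

theorem kernelForm_stepFun {N : ℕ} (G : SimpleGraph (Fin N)) {f : I → ℝ} (hf : Integrable f) :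
    kernelForm (stepFun G) f f = N * ∑ i, ∑ j, coupling G i j *
      ((∫ x in cell i, f x) * ∫ x in cell j, f x) := by
  have hint : ∀ i : Fin N, Integrable ((cell i).indicator f) := fun i =>
    hf.indicator (measurableSet_cell i)
  have h1 : ∀ p : I × I, stepFun G p.1 p.2 * (f p.1 * f p.2) = N * ∑ i, ∑ j, coupling G i j *
      ((cell i).indicator f p.1 * (cell j).indicator f p.2) := by
    intro p
    rw [stepFun_eq_sum, mul_assoc, Finset.sum_mul]
    congr 1
    refine Finset.sum_congr rfl fun i _ => ?_
    rw [Finset.sum_mul]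
    refine Finset.sum_congr rfl fun j _ => ?_
    by_cases hx : p.1 ∈ cell i <;> by_cases hy : p.2 ∈ cell j <;> simp [hx, hy]
  rw [kernelForm, integral_congr_ae (Eventually.of_forall h1), integral_const_mul]
  have hint2 : ∀ i j : Fin N, Integrable fun p : I × I => coupling G i j *
      ((cell i).indicator f p.1 * (cell j).indicator f p.2) := fun i j =>
    ((hint i).mul_prod (hint j)).const_mul _
  rw [integral_finsetSum _ fun i _ => integrable_finsetSum _ fun j _ => hint2 i j]
  congr 1
  refine Finset.sum_congr rfl fun i _ => ?_
  rw [integral_finsetSum _ fun j _ => hint2 i j]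
  refine Finset.sum_congr rfl fun j _ => ?_
  rw [integral_const_mul, Measure.volume_eq_prod, integral_prod_mul,
    integral_indicator (measurableSet_cell i), integral_indicator (measurableSet_cell j)]

/-- The step function with values `v` on the cells. -/
noncomputable def stepVec {N : ℕ} (v : Fin N → ℝ) (x : I) : ℝ :=
  ∑ i, (cell i).indicator (fun _ => v i) x

theorem stepVec_of_mem {N : ℕ} (v : Fin N → ℝ) {i : Fin N} {x : I} (h : x ∈ cell i) :
    stepVec v x = v i := by
  rw [stepVec, Finset.sum_eq_single i]
  · simp [h]
  · intro j _ hj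
    exact Set.indicator_of_notMem (fun h' => hj (eq_of_mem_cell h' h)) _
  · simp

theorem stepVec_of_forall_notMem {N : ℕ} (v : Fin N → ℝ) {x : I}
    (h : ∀ i : Fin N, x ∉ cell i) : stepVec v x = 0 :=
  Finset.sum_eq_zero fun i _ => Set.indicator_of_notMem (h i) _

theorem measurable_stepVec {N : ℕ} (v : Fin N → ℝ) : Measurable (stepVec v) := by
  unfold stepVec
  exact Finset.measurable_fun_sum _ fun i _ => measurable_const.indicator (measurableSet_cell i)

theorem abs_stepVec_le {N : ℕ} {v : Fin N → ℝ} {B : ℝ} (hB : 0 ≤ B) (hv : ∀ i, |v i| ≤ B)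
    (x : I) : |stepVec v x| ≤ B := by
  by_cases h : ∃ i : Fin N, x ∈ cell i
  · obtain ⟨i, hi⟩ := h
    rw [stepVec_of_mem v hi]; exact hv i
  · rw [stepVec_of_forall_notMem v (by simpa using h), abs_zero]; exact hB

theorem setIntegral_stepVec {N : ℕ} (v : Fin N → ℝ) (i : Fin N) :
    ∫ x in cell i, stepVec v x = v i / N := by
  rw [setIntegral_congr_fun (measurableSet_cell i) (g := fun _ => v i)
    (fun x hx => stepVec_of_mem v hx), setIntegral_const, volume_real_cell, smul_eq_mul]
  ring

theorem integral_stepVec_sq {N : ℕ} (v : Fin N → ℝ) :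
    ∫ x, stepVec v x ^ 2 = (∑ i, v i ^ 2) / N := by
  have h : ∀ x, stepVec v x ^ 2 = ∑ i, (cell i).indicator (fun _ => v i ^ 2) x := by
    intro x
    change _ = stepVec (fun i => v i ^ 2) x
    by_cases h : ∃ i : Fin N, x ∈ cell i
    · obtain ⟨i, hi⟩ := h
      rw [stepVec_of_mem _ hi, stepVec_of_mem _ hi]
    · push Not at h
      rw [stepVec_of_forall_notMem _ h, stepVec_of_forall_notMem _ h]; simp
  simp_rw [h]
  rw [integral_finsetSum _ fun i _ => (integrable_const _).indicator (measurableSet_cell i),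
    Finset.sum_div]
  refine Finset.sum_congr rfl fun i _ => ?_
  rw [integral_indicator (measurableSet_cell i), setIntegral_const, volume_real_cell, smul_eq_mul]
  ring

/-- Averaging over the cells does not increase the `L²` norm. -/
theorem sum_sq_average_le {N : ℕ} {f : I → ℝ} (hf : Measurable f) {B : ℝ}
    (hB : ∀ x, |f x| ≤ B) :
    (∑ i : Fin N, (N * ∫ x in cell i, f x) ^ 2) / N ≤ ∫ x, f x ^ 2 := by
  have hfi := integrable_of_measurable_of_abs_le hf hB
  have hf2 : Integrable fun x => f x ^ 2 :=
    integrable_of_measurable_of_abs_le (hf.pow_const 2) (B := B ^ 2) fun x => by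
      rw [abs_pow]; exact pow_le_pow_left₀ (abs_nonneg _) (hB x) 2
  have hcell : ∀ i : Fin N, (N * ∫ x in cell i, f x) ^ 2 / N ≤ ∫ x in cell i, f x ^ 2 := by
    intro i
    have hN : (0 : ℝ) < N := by exact_mod_cast i.pos
    set a : ℝ := ∫ x in cell i, f x with ha
    -- Nonnegativity of the variance of f on the cell, whose mean there is N * a.
    have h0 : 0 ≤ ∫ x in cell i, (f x - N * a) ^ 2 := integral_nonneg fun x => sq_nonneg _
    have e : ∫ x in cell i, (f x - N * a) ^ 2
        = ∫ x in cell i, f x ^ 2 - (2 * (N * a)) * f x + (N * a) ^ 2 :=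
      integral_congr_ae (Eventually.of_forall fun x => by simp only; ring)
    rw [e, integral_add (f := fun x => f x ^ 2 - 2 * (N * a) * f x)
        (hf2.restrict.sub (hfi.restrict.const_mul _)) (integrable_const _),
      integral_sub (g := fun x => 2 * (N * a) * f x) hf2.restrict (hfi.restrict.const_mul _), integral_const_mul, ← ha,
      setIntegral_const, volume_real_cell, smul_eq_mul] at h0
    have e2 : (N * a) ^ 2 / N = 2 * (N * a) * a - 1 / N * (N * a) ^ 2 := by
      field_simp; ring
    linarith
  rw [Finset.sum_div]
  calc ∑ i : Fin N, (N * ∫ x in cell i, f x) ^ 2 / N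
      ≤ ∑ i : Fin N, ∫ x in cell i, f x ^ 2 := Finset.sum_le_sum fun i _ => hcell i
    _ = ∫ x in ⋃ i : Fin N, cell i, f x ^ 2 := by
        rw [integral_iUnion_fintype (fun i => measurableSet_cell i) ?_ fun i => hf2.integrableOn]
        intro i j hij
        exact Set.disjoint_left.2 fun x hi hj => hij (eq_of_mem_cell hi hj)
    _ ≤ ∫ x, f x ^ 2 :=
        setIntegral_le_integral hf2 (Eventually.of_forall fun x => sq_nonneg _)

/-! Transfer between graphs and the limiting graphon -/

theorem cutNorm_nonneg (U : I → I → ℝ) : 0 ≤ cutNorm U :=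
  Real.sSup_nonneg fun _ ⟨_, _, _, _, h⟩ => h ▸ abs_nonneg _

theorem eventually_exists_cutNorm_lt {G : ∀ N : ℕ, SimpleGraph (Fin N)} {W : Graphon}
    (hG : ConvergesInCutMetric G W) {ε : ℝ} (hε : 0 < ε) :
    ∀ᶠ N in atTop, ∃ φ : I ≃ᵐ I, MeasurePreserving φ ∧
      cutNorm (fun x y => stepFun (G N) x y - W.toFun (φ x) (φ y)) < ε := by
  filter_upwards [hG.eventually_lt_const hε] with N hN
  have : Nonempty {φ : I ≃ᵐ I // MeasurePreserving φ} :=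
    ⟨⟨MeasurableEquiv.refl I, MeasurePreserving.id _⟩⟩
  obtain ⟨φ, hφ⟩ := exists_lt_of_ciInf_lt hN
  exact ⟨φ.1, φ.2, hφ⟩

/-- The relabelling is moved from W onto the test function, whose sup bound it preserves; the cut
norm then controls the difference. -/
theorem abs_kernelForm_sub_le {N : ℕ} (G : SimpleGraph (Fin N)) (W : Graphon) (φ : I ≃ᵐ I)
    (hφ : MeasurePreserving φ) {f : I → ℝ} (hf : Measurable f) {B : ℝ} (hB : ∀ x, |f x| ≤ B) :
    |kernelForm (stepFun G) f f - kernelForm W.toFun (f ∘ φ.symm) (f ∘ φ.symm)|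
      ≤ 4 * B ^ 2 * cutNorm (fun x y => stepFun G x y - W.toFun (φ x) (φ y)) := by
  have hfi := integrable_of_measurable_of_abs_le hf hB
  have hWm : Measurable (Function.uncurry fun x y => W.toFun (φ x) (φ y)) :=
    W.measurable'.comp ((φ.measurable.comp measurable_fst).prodMk
      (φ.measurable.comp measurable_snd))
  have hcomp : kernelForm W.toFun (f ∘ φ.symm) (f ∘ φ.symm)
      = kernelForm (fun x y => W.toFun (φ x) (φ y)) f f := by
    rw [← kernelForm_comp _ _ _ φ hφ]
    congr 1 <;> ext x <;> simp
  have hsub : kernelForm (stepFun G) f f - kernelForm (fun x y => W.toFun (φ x) (φ y)) f f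
      = kernelForm (fun x y => stepFun G x y - W.toFun (φ x) (φ y)) f f := by
    simp only [kernelForm, sub_mul]
    rw [integral_sub]
    · exact integrable_kernelForm_of_integrable (measurable_stepFun G)
        (fun x y => (ofGraph G).abs_le_one x y) hfi hfi
    · exact integrable_kernelForm_of_integrable hWm (fun x y => W.abs_le_one _ _) hfi hfi
  rw [hcomp, hsub]
  refine abs_kernelForm_le_cutNorm (C := 2) ?_ ?_ hf hB hf hB
  · exact (measurable_stepFun G).sub hWm
  · intro x y
    refine (abs_sub _ _).trans ?_
    have h1 := (ofGraph G).abs_le_one x y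
    have h2 := W.abs_le_one (φ x) (φ y)
    simp only [ofGraph] at h1
    linarith

theorem integral_sq_comp_symm (φ : I ≃ᵐ I) (hφ : MeasurePreserving φ) (f : I → ℝ) :
    ∫ x, (f ∘ φ.symm) x ^ 2 = ∫ x, f x ^ 2 :=
  (hφ.symm).integral_comp φ.symm.measurableEmbedding (fun x => f x ^ 2)

/-- Asymptotically, the eigenvalues of the coupling matrices do not exceed the norm of the
limiting graphon. -/
theorem eventually_eigenvalue_le {G : ∀ N : ℕ, SimpleGraph (Fin N)} {W : Graphon}
    (hG : ConvergesInCutMetric G W) (hW : 0 < graphonNorm W) {δ : ℝ} (hδ : 0 < δ) :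
    ∀ᶠ N in atTop, ∀ (l : ℝ) (v : Fin N → ℝ), v ≠ 0 → (coupling (G N)).mulVec v = l • v →
      l ≤ graphonNorm W + δ := by
  set w := graphonNorm W with hw
  -- Chosen so that the cut error 4B²ε is at most δ S/N, using l > w in B² = (S/N)/l².
  set ε : ℝ := δ * w ^ 2 / 4 with hε
  have hε0 : 0 < ε := by positivity
  filter_upwards [eventually_exists_cutNorm_lt hG hε0] with N ⟨φ, hφ, hcut⟩ l v hv hlv
  by_contra! hl
  have hlw : w < l := by linarith
  have hl0 : 0 < l := hW.trans hlw
  obtain ⟨i0, hi0⟩ := Function.ne_iff.1 hv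
  have hN : (0 : ℝ) < N := by exact_mod_cast i0.pos
  set S : ℝ := ∑ i, v i ^ 2 with hS
  have hS0 : 0 < S := by
    refine lt_of_lt_of_le (pow_pos (abs_pos.2 hi0) 2) ?_
    rw [sq_abs]
    exact Finset.single_le_sum (f := fun i => v i ^ 2) (fun i _ => sq_nonneg _)
      (Finset.mem_univ i0)
  -- Eigenvectors are flat: entries of the coupling are at most 1/N, so l |v_i| is at most the mean
  -- of |v_j|, which is at most √(S/N).
  set B : ℝ := √(S / N) / l with hB
  have hB0 : 0 ≤ B := by positivity
  have hB2 : B ^ 2 = S / N / l ^ 2 := by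
    rw [hB, div_pow, Real.sq_sqrt (by positivity)]
  have hvB : ∀ i, |v i| ≤ B := by
    intro i
    have h1 : l * v i = ∑ j, coupling (G N) i j * v j := (congrFun hlv i).symm
    have h2 : l * |v i| ≤ ∑ j, |v j| / N := by
      rw [← abs_of_pos hl0, ← abs_mul, h1]
      refine (Finset.abs_sum_le_sum_abs _ _).trans (Finset.sum_le_sum fun j _ => ?_)
      rw [abs_mul, abs_of_nonneg (coupling_nonneg _ _ _), div_eq_mul_one_div, mul_comm]
      exact mul_le_mul_of_nonneg_left (coupling_le _ _ _) (abs_nonneg _)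
    have h3 : ∑ j, |v j| / N ≤ √(S / N) := by
      refine Real.le_sqrt_of_sq_le ?_
      rw [← Finset.sum_div, div_pow]
      have h4 := sq_sum_le_card_mul_sum_sq (s := Finset.univ) (f := fun j => |v j|)
      simp only [sq_abs, Finset.card_univ, Fintype.card_fin] at h4
      rw [div_le_div_iff₀ (by positivity) hN]
      nlinarith
    rw [hB, le_div_iff₀ hl0]
    linarith
  have hform : kernelForm (stepFun (G N)) (stepVec v) (stepVec v) = l * (S / N) := by
    rw [kernelForm_stepFun (G N)
      (integrable_of_measurable_of_abs_le (measurable_stepVec v) (abs_stepVec_le hB0 hvB))]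
    simp_rw [setIntegral_stepVec]
    have h1 : ∀ i, ∑ j, coupling (G N) i j * (v i / N * (v j / N)) = l * v i ^ 2 / N ^ 2 := by
      intro i
      have h2 : l * v i = ∑ j, coupling (G N) i j * v j := (congrFun hlv i).symm
      rw [show l * v i ^ 2 / (N : ℝ) ^ 2 = (l * v i) * (v i / N ^ 2) by ring, h2, Finset.sum_mul]
      exact Finset.sum_congr rfl fun j _ => by ring
    simp_rw [h1, ← Finset.sum_div, ← Finset.mul_sum]
    rw [← hS]; field_simp
  have hdiff := (abs_le.1 (abs_kernelForm_sub_le (G N) W φ hφ (measurable_stepVec v)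
    (abs_stepVec_le hB0 hvB))).2
  have hup := kernelForm_le_graphonNorm W (f := stepVec v ∘ φ.symm)
    ((measurable_stepVec v).comp φ.symm.measurable) (B := B)
    (fun x => abs_stepVec_le hB0 hvB _)
  rw [integral_sq_comp_symm φ hφ, integral_stepVec_sq, ← hS, ← hw] at hup
  rw [hform, hB2] at hdiff
  have hx : 0 < S / N := by positivity
  have h5 : 4 * (S / N / l ^ 2) *
      cutNorm (fun x y => stepFun (G N) x y - W.toFun (φ x) (φ y)) ≤ δ * (S / N) := by
    calc _ ≤ 4 * (S / N / w ^ 2) * ε := by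
          have := cutNorm_nonneg fun x y => stepFun (G N) x y - W.toFun (φ x) (φ y)
          gcongr
      _ = δ * (S / N) := by rw [hε]; field_simp
  nlinarith

/-- Asymptotically, the quadratic forms of the coupling matrices reach the norm of the limiting
graphon, at vectors with bounded entries. -/
theorem exists_eventually_quadratic_ge {G : ∀ N : ℕ, SimpleGraph (Fin N)} {W : Graphon}
    (hG : ConvergesInCutMetric G W) {c : ℝ} (hc : 0 ≤ c) (hcW : c < graphonNorm W) :
    ∃ B > 0, ∃ η > 0, ∀ᶠ N : ℕ in atTop, ∃ u : Fin N → ℝ, (∀ i, |u i| ≤ B) ∧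
      c * ∑ i, u i ^ 2 + η * N ≤ ∑ i, ∑ j, coupling (G N) i j * u i * u j := by
  obtain ⟨f, hf, ⟨B', hB'⟩, hlt⟩ := exists_lt_kernelForm W hc hcW
  set B : ℝ := |B'| + 1 with hBdef
  have hB0 : 0 < B := by positivity
  have hB : ∀ x, |f x| ≤ B := fun x => (hB' x).trans (by linarith [le_abs_self B'])
  -- Half of the gap is spent on the cut-norm error; the other half survives.
  set η : ℝ := (kernelForm W.toFun f f - c * ∫ x, f x ^ 2) / 2 with hη
  have hη0 : 0 < η := by rw [hη]; linarith
  refine ⟨B, hB0, η, hη0, ?_⟩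
  filter_upwards [eventually_exists_cutNorm_lt hG (ε := η / (4 * B ^ 2)) (by positivity),
    eventually_gt_atTop 0] with N ⟨φ, hφ, hcut⟩ hNpos
  have hN : (0 : ℝ) < N := by exact_mod_cast hNpos
  -- The test function is carried to the labelling of the graph; its cell averages form the vector
  -- u.
  set g : I → ℝ := f ∘ φ with hg
  have hgm : Measurable g := hf.comp φ.measurable
  have hgB : ∀ x, |g x| ≤ B := fun x => hB _
  have hgs : g ∘ φ.symm = f := by ext x; simp [hg]
  refine ⟨fun i => N * ∫ x in cell i, g x, fun i => ?_, ?_⟩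
  · have h1 : ‖∫ x in cell i, g x‖ ≤ B * volume.real (cell i) :=
      norm_setIntegral_le_of_norm_le_const (measure_lt_top _ _) fun x _ => hgB x
    rw [volume_real_cell, Real.norm_eq_abs] at h1
    rw [abs_mul, abs_of_pos hN]
    calc _ ≤ N * (B * (1 / N)) := by gcongr
      _ = B := by field_simp
  · have hdiff := (abs_le.1 (abs_kernelForm_sub_le (G N) W φ hφ hgm hgB)).1
    have hsq := sum_sq_average_le (N := N) hgm hgB
    rw [← integral_sq_comp_symm φ hφ, hgs] at hsq
    rw [hgs, kernelForm_stepFun _ (integrable_of_measurable_of_abs_le hgm hgB)] at hdiff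
    have h5 : 4 * B ^ 2 * cutNorm (fun x y => stepFun (G N) x y - W.toFun (φ x) (φ y)) ≤ η := by
      calc _ ≤ 4 * B ^ 2 * (η / (4 * B ^ 2)) := by gcongr
        _ = η := by field_simp
    have e : ∑ i, ∑ j, coupling (G N) i j * (N * ∫ x in cell i, g x) * (N * ∫ x in cell j, g x)
        = N * (N * ∑ i, ∑ j, coupling (G N) i j * ((∫ x in cell i, g x) * ∫ x in cell j, g x)) := by
      simp only [Finset.mul_sum]
      exact Finset.sum_congr rfl fun i _ => Finset.sum_congr rfl fun j _ => by ring
    rw [e]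
    rw [div_le_iff₀ hN] at hsq
    have h6 : c * ∑ i : Fin N, (N * ∫ x in cell i, g x) ^ 2 ≤ c * ((∫ x, f x ^ 2) * N) := by
      gcongr
    have h7 : c * (∫ x, f x ^ 2) + η
        ≤ N * ∑ i, ∑ j, coupling (G N) i j * ((∫ x in cell i, g x) * ∫ x in cell j, g x) := by
      linarith
    have h8 := mul_le_mul_of_nonneg_left h7 hN.le
    linarith

/-! Absence of consistent tests in the subcritical regime -/

theorem logPartition_zero {N : ℕ} (J : Matrix (Fin N) (Fin N) ℝ) : logPartition J 0 = 0 := by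
  simp [logPartition]

theorem eventually_logPartition_le {G : ∀ N : ℕ, SimpleGraph (Fin N)} {W : Graphon}
    (hG : ConvergesInCutMetric G W) (hW : 0 < graphonNorm W) {β : ℝ} (hβ0 : 0 ≤ β)
    (hβ : β < 1 / graphonNorm W) :
    ∃ C, ∀ᶠ N in atTop, logPartition (coupling (G N)) β ≤ C := by
  rcases hβ0.eq_or_lt with rfl | hpos
  · exact ⟨0, Eventually.of_forall fun N => (logPartition_zero _).le⟩
  -- An eigenvalue excess of δ/β uses half of the spectral gap and leaves δ.
  set δ : ℝ := (1 - β * graphonNorm W) / 2 with hδ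
  have hδ0 : 0 < δ := by
    rw [lt_div_iff₀ hW] at hβ
    rw [hδ]; linarith
  refine ⟨β ^ 2 / (2 * δ), ?_⟩
  filter_upwards [eventually_eigenvalue_le hG hW (div_pos hδ0 hpos)] with N hN
  refine logPartition_le _ (coupling_self _) (coupling_comm _) (sum_coupling_sq_le _) hpos hδ0 ?_
  intro l v hv hlv
  have h := mul_le_mul_of_nonneg_left (hN l v hv hlv) hpos.le
  rw [mul_add, mul_div_cancel₀ _ hpos.ne'] at h
  rw [hδ] at h ⊢
  linarith

/-- Change of measure for the expectation of a test. -/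
theorem isingExp_test_le {N : ℕ} (J : Matrix (Fin N) (Fin N) ℝ) (hJ : ∀ i, J i i = 0)
    {β₁ β₂ β₃ C₁ C₃ K : ℝ} (h12 : β₁ ≤ β₂) (h23 : β₂ ≤ β₃) (h1 : logPartition J β₁ ≤ C₁)
    (h3 : logPartition J β₃ ≤ C₃) {f : Spins N → ℝ} (hf0 : ∀ τ, 0 ≤ f τ) (hf1 : ∀ τ, f τ ≤ 1) :
    isingExp J β₂ f ≤ Real.exp (1 / 2 * (β₂ - β₁) * K + C₁) * isingExp J β₁ f
      + Real.exp (C₃ - 1 / 2 * (β₃ - β₂) * K) := by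
  have h2 := logPartition_nonneg J hJ β₂
  have htail : Real.exp (-(1 / 2 * (β₃ - β₂) * K)) *
      isingExp J β₂ (fun τ => Real.exp (1 / 2 * (β₃ - β₂) * energy J τ))
      ≤ Real.exp (C₃ - 1 / 2 * (β₃ - β₂) * K) := by
    rw [isingExp_exp_energy, ← Real.exp_add, Real.exp_le_exp]
    linarith
  refine le_trans ?_ (add_le_add_right htail _)
  rw [isingExp, isingExp, isingExp, Finset.mul_sum, Finset.mul_sum, ← Finset.sum_add_distrib]
  refine Finset.sum_le_sum fun τ _ => ?_
  have hp1 := (isingProb_pos J β₁ τ).le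
  have hp2 := (isingProb_pos J β₂ τ).le
  -- For energy at most K the likelihood ratio is bounded, since `logPartition` at β₂ is
  -- nonnegative; otherwise the term is absorbed by the exponential moment obtained by tilting to
  -- β₃.
  rcases le_total (energy J τ) K with h | h
  · have key : isingProb J β₂ τ ≤
        Real.exp (1 / 2 * (β₂ - β₁) * K + C₁) * isingProb J β₁ τ := by
      rw [isingProb, isingProb, mul_left_comm, ← Real.exp_add]
      gcongr
      have := mul_le_mul_of_nonneg_left h (sub_nonneg.2 h12)
      linarith
    have e := mul_le_mul_of_nonneg_right key (hf0 τ)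
    have : 0 ≤ Real.exp (-(1 / 2 * (β₃ - β₂) * K)) *
      (isingProb J β₂ τ * Real.exp (1 / 2 * (β₃ - β₂) * energy J τ)) := by positivity
    linarith
  · have key : 1 ≤ Real.exp (-(1 / 2 * (β₃ - β₂) * K)) *
        Real.exp (1 / 2 * (β₃ - β₂) * energy J τ) := by
      rw [← Real.exp_add, Real.one_le_exp_iff]
      have := mul_le_mul_of_nonneg_left h (sub_nonneg.2 h23)
      linarith
    have e1 := mul_le_mul_of_nonneg_left key hp2
    have e2 := mul_le_mul_of_nonneg_left (hf1 τ) hp2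
    have : 0 ≤ Real.exp (1 / 2 * (β₂ - β₁) * K + C₁) * (isingProb J β₁ τ * f τ) :=
      mul_nonneg (Real.exp_pos _).le (mul_nonneg hp1 (hf0 τ))
    linarith

theorem not_exists_isConsistentTest {G : ∀ N : ℕ, SimpleGraph (Fin N)} {W : Graphon}
    (hG : ConvergesInCutMetric G W) (hW : 0 < graphonNorm W) {β₁ β₂ : ℝ} (h0 : 0 ≤ β₁)
    (h12 : β₁ < β₂) (h2 : β₂ < 1 / graphonNorm W) :
    ¬ ∃ φ : ∀ N : ℕ, Spins N → Fin 2, IsConsistentTest (fun N => coupling (G N)) β₁ β₂ φ := by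
  rintro ⟨φ, hφ1, hφ2⟩
  obtain ⟨β₃, h23, h3⟩ := exists_between h2
  obtain ⟨C₁, hC₁⟩ := eventually_logPartition_le hG hW h0 (h12.trans h2)
  obtain ⟨C₃, hC₃⟩ := eventually_logPartition_le hG hW (by linarith : 0 ≤ β₃) h3
  -- This makes the tail term exp(-1); anything below 1 would do.
  set K : ℝ := (C₃ + 1) / (1 / 2 * (β₃ - β₂)) with hK
  have hK' : C₃ - 1 / 2 * (β₃ - β₂) * K = -1 := by
    have : β₃ - β₂ ≠ 0 := by linarith
    rw [hK]; field_simp; ring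
  have hle : ∀ᶠ N in atTop, isingExp (coupling (G N)) β₂ (fun τ => ((φ N τ : ℕ) : ℝ))
      ≤ Real.exp (1 / 2 * (β₂ - β₁) * K + C₁) *
        isingExp (coupling (G N)) β₁ (fun τ => ((φ N τ : ℕ) : ℝ)) + Real.exp (-1) := by
    filter_upwards [hC₁, hC₃] with N h1 h3
    rw [← hK']
    refine isingExp_test_le _ (coupling_self _) h12.le h23.le h1 h3 (fun τ => by positivity) ?_
    intro τ
    have : (φ N τ : ℕ) ≤ 1 := by omega
    exact_mod_cast this
  have hlim := le_of_tendsto_of_tendsto hφ2 ((hφ1.const_mul _).add_const _) hle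
  rw [mul_zero, zero_add] at hlim
  have : Real.exp (-1) < 1 := by rw [Real.exp_lt_one_iff]; norm_num
  linarith

/-! The hyperbolic tangent -/

theorem tanh_sub_tanh (a b : ℝ) :
    Real.tanh b - Real.tanh a = Real.sinh (b - a) / (Real.cosh a * Real.cosh b) := by
  have ha := (Real.cosh_pos a).ne'
  have hb := (Real.cosh_pos b).ne'
  rw [Real.tanh_eq_sinh_div_cosh, Real.tanh_eq_sinh_div_cosh, Real.sinh_sub]
  field_simp

theorem abs_tanh_le_one (x : ℝ) : |Real.tanh x| ≤ 1 := by
  have h := Real.cosh_pos x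
  rw [Real.tanh_eq_sinh_div_cosh, abs_div, abs_of_pos h, div_le_one h]
  refine abs_le_of_sq_le_sq ?_ h.le
  have := Real.cosh_sq x
  linarith

theorem abs_tanh_sub_tanh_le (a b : ℝ) : |Real.tanh b - Real.tanh a| ≤ |b - a| := by
  have hd : ∀ x : ℝ, HasDerivAt Real.tanh (1 / Real.cosh x ^ 2) x := by
    intro x
    have hx := (Real.cosh_pos x).ne'
    have h := (Real.hasDerivAt_sinh x).div (Real.hasDerivAt_cosh x) hx
    have e : Real.tanh = Real.sinh / Real.cosh := by
      ext y; rw [Real.tanh_eq_sinh_div_cosh, Pi.div_apply]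
    rw [e]
    refine h.congr_deriv ?_
    have := Real.cosh_sq x
    rw [← sq, ← sq]
    congr 1
    linarith
  have h := convex_univ.norm_image_sub_le_of_norm_hasDerivWithin_le (C := 1) (x := a) (y := b)
    (f := Real.tanh) (f' := fun x => 1 / Real.cosh x ^ 2)
    (fun x _ => (hd x).hasDerivWithinAt) (fun x _ => by
      have h1 := Real.one_le_cosh x
      rw [Real.norm_eq_abs, abs_of_nonneg (by positivity), div_le_one (by positivity)]
      nlinarith) (Set.mem_univ _) (Set.mem_univ _)
  simpa using h

theorem continuous_tanh : Continuous Real.tanh := by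
  have e : Real.tanh = fun x => Real.sinh x / Real.cosh x := by
    ext y; rw [Real.tanh_eq_sinh_div_cosh]
  rw [e]
  exact Real.continuous_sinh.div Real.continuous_cosh fun x => (Real.cosh_pos x).ne'

/-- By `tanh_sub_tanh`, sinh z ≥ z for z ≥ 0, and cosh (z m) ≤ cosh X; oddness of tanh reduces to m
≥ 0. It bounds the slope of the score from below. -/
theorem mul_tanh_sub_tanh_ge {m x y X : ℝ} (hm : |m| ≤ 1) (hx : 0 ≤ x) (hxy : x ≤ y)
    (hyX : y ≤ X) :
    m ^ 2 * ((y - x) / Real.cosh X ^ 2) ≤ m * (Real.tanh (y * m) - Real.tanh (x * m)) := by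
  wlog hm0 : 0 ≤ m generalizing m
  · have h := this (m := -m) (by rwa [abs_neg]) (by linarith)
    simp only [mul_neg, Real.tanh_neg] at h
    linarith
  rw [abs_of_nonneg hm0] at hm
  have hc : ∀ z, 0 ≤ z → z ≤ X → Real.cosh (z * m) ≤ Real.cosh X := by
    intro z hz hzX
    rw [Real.cosh_le_cosh, abs_of_nonneg (by positivity), abs_of_nonneg (hz.trans hzX)]
    nlinarith
  rw [sq, mul_assoc]
  refine mul_le_mul_of_nonneg_left ?_ hm0
  rw [tanh_sub_tanh, ← mul_div_assoc]
  have h1 : m * (y - x) ≤ Real.sinh (y * m - x * m) := by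
    have : 0 ≤ y * m - x * m := by nlinarith
    have := Real.self_le_sinh_iff.2 this
    linarith
  have h2 := hc x hx (hxy.trans hyX)
  have h3 := hc y (hx.trans hxy) hyX
  have h4 := Real.cosh_pos (x * m)
  have h5 := Real.cosh_pos (y * m)
  have h6 := Real.cosh_pos X
  have h7 : 0 ≤ Real.sinh (y * m - x * m) :=
    (mul_nonneg hm0 (sub_nonneg.2 hxy)).trans h1
  rw [sq]
  gcongr

/-! Concentration of the score -/

theorem isingExp_sum {N : ℕ} (J : Matrix (Fin N) (Fin N) ℝ) (β : ℝ) {ι : Type*}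
    (s : Finset ι) (f : ι → Spins N → ℝ) :
    isingExp J β (fun τ => ∑ i ∈ s, f i τ) = ∑ i ∈ s, isingExp J β (f i) := by
  simp only [isingExp, Finset.mul_sum]
  exact Finset.sum_comm

theorem isingExp_add {N : ℕ} (J : Matrix (Fin N) (Fin N) ℝ) (β : ℝ) (f g : Spins N → ℝ) :
    isingExp J β (fun τ => f τ + g τ) = isingExp J β f + isingExp J β g := by
  simp only [isingExp, mul_add, Finset.sum_add_distrib]

theorem isingExp_const_mul {N : ℕ} (J : Matrix (Fin N) (Fin N) ℝ) (β c : ℝ) (f : Spins N → ℝ) :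
    isingExp J β (fun τ => c * f τ) = c * isingExp J β f := by
  simp only [isingExp, Finset.mul_sum]
  exact Finset.sum_congr rfl fun τ _ => by ring

theorem abs_localField_le {N : ℕ} {J : Matrix (Fin N) (Fin N) ℝ}
    (hJ1 : ∀ i j, |J i j| ≤ 1 / N) (τ : Spins N) (i : Fin N) : |localField J τ i| ≤ 1 := by
  have hN : (N : ℝ) ≠ 0 := by exact_mod_cast i.pos.ne'
  calc |localField J τ i| ≤ ∑ j, |J i j * spin τ j| := Finset.abs_sum_le_sum_abs _ _
    _ ≤ ∑ _j : Fin N, 1 / (N : ℝ) := by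
        refine Finset.sum_le_sum fun j _ => ?_
        rw [abs_mul, abs_spin, mul_one]; exact hJ1 i j
    _ = 1 := by simp [hN]

/-- The residual `σ_i - tanh (β m_i)`. -/
noncomputable def residual {N : ℕ} (J : Matrix (Fin N) (Fin N) ℝ) (β : ℝ) (τ : Spins N)
    (i : Fin N) : ℝ := spin τ i - Real.tanh (β * localField J τ i)

theorem abs_residual_le {N : ℕ} (J : Matrix (Fin N) (Fin N) ℝ) (β : ℝ) (τ : Spins N)
    (i : Fin N) : |residual J β τ i| ≤ 2 := by
  refine (abs_sub _ _).trans ?_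
  rw [abs_spin]
  have := abs_tanh_le_one (β * localField J τ i)
  linarith

theorem abs_mul_sub_tanh_sub_le {s m d β : ℝ} (hβ : 0 ≤ β) (hs : |s| ≤ 1) (hm : |m - d| ≤ 2) :
    |m * (s - Real.tanh (β * m)) - (m - d) * (s - Real.tanh (β * (m - d)))|
      ≤ (2 + 2 * β) * |d| := by
  have e : m * (s - Real.tanh (β * m)) - (m - d) * (s - Real.tanh (β * (m - d)))
      = d * (s - Real.tanh (β * m)) + (m - d) * (Real.tanh (β * (m - d)) - Real.tanh (β * m)) := by
    ring
  rw [e]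
  refine (abs_add_le _ _).trans ?_
  rw [abs_mul, abs_mul]
  have h1 : |s - Real.tanh (β * m)| ≤ 2 := by
    have := abs_sub s (Real.tanh (β * m))
    have := abs_tanh_le_one (β * m)
    linarith
  have h2 : |Real.tanh (β * (m - d)) - Real.tanh (β * m)| ≤ β * |d| := by
    refine (abs_tanh_sub_tanh_le _ _).trans (le_of_eq ?_)
    rw [show β * (m - d) - β * m = -(β * d) by ring, abs_neg, abs_mul, abs_of_nonneg hβ]
  have h3 := mul_le_mul_of_nonneg_left h1 (abs_nonneg d)
  have h4 := mul_le_mul hm h2 (abs_nonneg _) (by norm_num)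
  linarith

/-- Removing the contribution of σ_i from m_j changes the j-th factor by at most (2 + 2β)/N and
makes it independent of σ_i. The resulting product has mean zero by conditioning on all spins but
σ_i; the first factor, at most 2 in absolute value, multiplies the error. -/
theorem isingExp_residual_pair_le {N : ℕ} {J : Matrix (Fin N) (Fin N) ℝ} (hJ : ∀ i, J i i = 0)
    (hs : ∀ i j, J i j = J j i) (hJ1 : ∀ i j, |J i j| ≤ 1 / N) {β : ℝ} (hβ : 0 ≤ β)
    {i j : Fin N} (hij : i ≠ j) :
    isingExp J β (fun τ => (localField J τ i * residual J β τ i) *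
      (localField J τ j * residual J β τ j)) ≤ (4 + 4 * β) / N := by
  have hN : (1 : ℝ) ≤ N := by exact_mod_cast i.pos
  set d : Spins N → ℝ := fun τ => J j i * spin τ i with hd
  have hdle : ∀ τ, |d τ| ≤ 1 / N := fun τ => by
    rw [hd, abs_mul, abs_spin, mul_one]; exact hJ1 j i
  set g : Spins N → ℝ := fun τ => (localField J τ j - d τ) *
    (spin τ j - Real.tanh (β * (localField J τ j - d τ))) with hg
  have hginv : ∀ τ, localField J (flipSpin i τ) i * g (flipSpin i τ) = localField J τ i * g τ := by
    intro τ
    have e : localField J (flipSpin i τ) j - d (flipSpin i τ) = localField J τ j - d τ := by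
      simp only [hd, localField_flipSpin, spin_flipSpin_self]; ring
    simp only [hg, e, spin_flipSpin_of_ne hij.symm]
    rw [localField_flipSpin, hJ]; ring
  have h0 := isingExp_sub_tanh_mul J hJ hs β i (fun τ => localField J τ i * g τ) hginv
  have hle : ∀ τ, (localField J τ i * residual J β τ i) * (localField J τ j * residual J β τ j)
      ≤ (spin τ i - Real.tanh (β * localField J τ i)) * (localField J τ i * g τ)
        + (4 + 4 * β) / N := by
    intro τ
    have h1 := abs_localField_le hJ1 τ i
    have h2 := abs_residual_le J β τ i
    have h3 : |localField J τ j * residual J β τ j - g τ| ≤ (2 + 2 * β) * (1 / N) := by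
      refine (abs_mul_sub_tanh_sub_le hβ (abs_spin τ j).le ?_).trans ?_
      · have := abs_sub (localField J τ j) (d τ)
        have := abs_localField_le hJ1 τ j
        have := hdle τ
        have : 1 / (N : ℝ) ≤ 1 := by rw [div_le_one (by linarith)]; exact hN
        linarith
      · exact mul_le_mul_of_nonneg_left (hdle τ) (by linarith)
    have h4 : (localField J τ i * residual J β τ i) *
        (localField J τ j * residual J β τ j - g τ) ≤ (4 + 4 * β) / N := by
      refine (le_abs_self _).trans ?_
      rw [abs_mul, abs_mul]
      calc _ ≤ (1 * 2) * ((2 + 2 * β) * (1 / N)) := by gcongr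
        _ = _ := by ring
    have h5 : residual J β τ i = spin τ i - Real.tanh (β * localField J τ i) := rfl
    rw [← h5]
    linarith
  refine (isingExp_mono J β hle).trans (le_of_eq ?_)
  rw [isingExp_add, h0, isingExp_const, zero_add]

theorem score_eq {N : ℕ} (J : Matrix (Fin N) (Fin N) ℝ) (τ : Spins N) (β : ℝ) :
    score J τ β = (1 / N) * ∑ i, localField J τ i * residual J β τ i := rfl

/-- The score at the true parameter has second moment of order `1 / N`. -/
theorem isingExp_score_sq_le {N : ℕ} {J : Matrix (Fin N) (Fin N) ℝ} (hN : 0 < N)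
    (hJ : ∀ i, J i i = 0) (hs : ∀ i j, J i j = J j i) (hJ1 : ∀ i j, |J i j| ≤ 1 / N) {β : ℝ}
    (hβ : 0 ≤ β) :
    isingExp J β (fun τ => score J τ β ^ 2) ≤ (8 + 4 * β) / N := by
  have hN' : (0 : ℝ) < N := by exact_mod_cast hN
  have e : ∀ τ, score J τ β ^ 2 = (1 / N) ^ 2 * ∑ i, ∑ j,
      (localField J τ i * residual J β τ i) * (localField J τ j * residual J β τ j) := by
    intro τ
    rw [score_eq, mul_pow, sq (∑ i, _), Finset.sum_mul_sum]
  simp_rw [e]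
  rw [isingExp_const_mul, isingExp_sum]
  -- For simplicity the off-diagonal error is also allowed on the diagonal, whence 8 = 4 + 4 in the
  -- final constant.
  have hpair : ∀ i j : Fin N, isingExp J β (fun τ => (localField J τ i * residual J β τ i) *
      (localField J τ j * residual J β τ j)) ≤ (if i = j then 4 else 0) + (4 + 4 * β) / N := by
    intro i j
    split_ifs with h
    · subst h
      have hle : isingExp J β (fun τ => (localField J τ i * residual J β τ i) *
          (localField J τ i * residual J β τ i)) ≤ 4 := by
        rw [← isingExp_const J β 4]
        refine isingExp_mono J β fun τ => ?_
        have h1 := abs_localField_le hJ1 τ i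
        have h2 := abs_residual_le J β τ i
        have h3 : |localField J τ i * residual J β τ i| ≤ 2 := by
          rw [abs_mul]
          calc _ ≤ 1 * (2 : ℝ) := by gcongr
            _ = 2 := by norm_num
        rw [← abs_mul_abs_self]
        nlinarith [abs_nonneg (localField J τ i * residual J β τ i)]
      have : 0 ≤ (4 + 4 * β) / N := by positivity
      linarith
    · rw [zero_add]; exact isingExp_residual_pair_le hJ hs hJ1 hβ h
  calc _ ≤ (1 / (N : ℝ)) ^ 2 *
        ∑ i : Fin N, ∑ j : Fin N, ((if i = j then 4 else 0) + (4 + 4 * β) / N) := by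
        gcongr with i _
        rw [isingExp_sum]
        exact Finset.sum_le_sum fun j _ => hpair i j
    _ = (8 + 4 * β) / N := by
        simp only [Finset.sum_add_distrib, Finset.sum_ite_eq, Finset.mem_univ, if_true,
          Finset.sum_const, Finset.card_univ, Fintype.card_fin, nsmul_eq_mul]
        field_simp
        ring

/-! The maximum pseudolikelihood estimator as a zero of the score -/

theorem continuous_score {N : ℕ} (J : Matrix (Fin N) (Fin N) ℝ) (τ : Spins N) :
    Continuous (score J τ) := by
  unfold score
  refine continuous_const.mul (continuous_finsetSum _ fun i _ => continuous_const.mul ?_)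
  exact continuous_const.sub (continuous_tanh.comp (continuous_id.mul continuous_const))

theorem score_sub_score_ge {N : ℕ} {J : Matrix (Fin N) (Fin N) ℝ}
    (hJ1 : ∀ i j, |J i j| ≤ 1 / N) (τ : Spins N) {x y X : ℝ} (hx : 0 ≤ x) (hxy : x ≤ y)
    (hyX : y ≤ X) :
    (1 / N * ∑ i, localField J τ i ^ 2) * ((y - x) / Real.cosh X ^ 2)
      ≤ score J τ x - score J τ y := by
  have e : score J τ x - score J τ y = 1 / N * ∑ i, localField J τ i *
      (Real.tanh (y * localField J τ i) - Real.tanh (x * localField J τ i)) := by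
    rw [score, score, ← mul_sub, ← Finset.sum_sub_distrib]
    congr 1
    exact Finset.sum_congr rfl fun i _ => by ring
  rw [e, mul_assoc, Finset.sum_mul]
  refine mul_le_mul_of_nonneg_left ?_ (by positivity)
  exact Finset.sum_le_sum fun i _ =>
    mul_tanh_sub_tanh_ge (abs_localField_le hJ1 τ i) hx hxy hyX

/-- The slope bound forces a sign change of the score between β - r and β + r, hence a zero there.
The conditions r ≤ β and r ≤ 1 keep this interval inside [0, β + 1], where the slope bound applies.
-/
theorem mple_mem_of_score {N : ℕ} {J : Matrix (Fin N) (Fin N) ℝ}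
    (hJ1 : ∀ i j, |J i j| ≤ 1 / N) (τ : Spins N) {β r : ℝ} (hr0 : 0 ≤ r) (hrβ : r ≤ β)
    (hr1 : r ≤ 1)
    (hscore : |score J τ β| < (1 / N * ∑ i, localField J τ i ^ 2) *
      (r / Real.cosh (β + 1) ^ 2)) :
    mple J τ ≠ ⊤ ∧ |(mple J τ).toReal - β| ≤ r := by
  have habs := abs_lt.1 hscore
  have h1 := score_sub_score_ge hJ1 τ (x := β - r) (y := β) (X := β + 1) (by linarith)
    (by linarith) (by linarith)
  have h2 := score_sub_score_ge hJ1 τ (x := β) (y := β + r) (X := β + 1) (by linarith)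
    (by linarith) (by linarith)
  rw [sub_sub_cancel] at h1
  rw [add_sub_cancel_left] at h2
  have hpos : 0 < score J τ (β - r) := by linarith
  have hneg : score J τ (β + r) < 0 := by linarith
  obtain ⟨x, ⟨hx1, hx2⟩, hx⟩ := intermediate_value_Icc' (by linarith : β - r ≤ β + r)
    (continuous_score J τ).continuousOn ⟨hneg.le, hpos.le⟩
  lift x to ℝ≥0 using by linarith
  lift β - r to ℝ≥0 using sub_nonneg.2 hrβ with b hb
  have hle : mple J τ ≤ (x : ℝ≥0∞) := sInf_le ⟨x, rfl, hx⟩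
  have htop : mple J τ ≠ ⊤ := ne_top_of_le_ne_top ENNReal.coe_ne_top hle
  -- The infimum runs over all zeros, so earlier ones must be excluded: on [0, β - r] the score is
  -- nonincreasing, hence positive.
  have hge : (b : ℝ≥0∞) ≤ mple J τ := by
    refine le_sInf ?_
    rintro y ⟨z, rfl, hz⟩
    rw [ENNReal.coe_le_coe, ← NNReal.coe_le_coe]
    by_contra! hlt
    have h3 := score_sub_score_ge hJ1 τ (x := z) (y := b) (X := β + 1) z.2 hlt.le
      (by linarith)
    have h4 : 0 ≤ (1 / N * ∑ i, localField J τ i ^ 2) *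
        ((b - z) / Real.cosh (β + 1) ^ 2) := by
      have : 0 ≤ ∑ i, localField J τ i ^ 2 := Finset.sum_nonneg fun i _ => sq_nonneg _
      have : (0 : ℝ) ≤ b - z := sub_nonneg.2 hlt.le
      positivity
    linarith
  refine ⟨htop, ?_⟩
  have h5 := ENNReal.toReal_mono ENNReal.coe_ne_top hle
  have h6 := ENNReal.toReal_mono htop hge
  simp only [ENNReal.coe_toReal] at h5 h6
  rw [abs_le]
  constructor <;> linarith

/-- Cauchy–Schwarz for ∑ σ_i m_i; an energy of order N thus forces ∑ m_i² to be of order N. -/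
theorem sq_energy_le {N : ℕ} (J : Matrix (Fin N) (Fin N) ℝ) (τ : Spins N) :
    energy J τ ^ 2 ≤ N * ∑ i, localField J τ i ^ 2 := by
  rw [energy_eq_sum_localField]
  refine (Finset.sum_mul_sq_le_sq_mul_sq _ _ _).trans (le_of_eq ?_)
  congr 1
  simp [sq, spin_mul_self]

/-! Consistency in the supercritical regime -/

/-- With means s u, the quadratic gain exceeds the leading entropy cost by order s² N, while the
quartic remainder is of order s⁴ N; a small s wins. -/
theorem exists_eventually_logPartition_ge {G : ∀ N : ℕ, SimpleGraph (Fin N)} {W : Graphon}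
    (hG : ConvergesInCutMetric G W) (hW : 0 < graphonNorm W) {β : ℝ}
    (hβ : 1 / graphonNorm W < β) :
    ∃ κ > 0, ∀ᶠ N : ℕ in atTop, κ * N ≤ logPartition (coupling (G N)) β := by
  have hβ0 : 0 < β := lt_trans (by positivity) hβ
  obtain ⟨B, hB, η, hη, hev⟩ := exists_eventually_quadratic_ge hG (c := 1 / β) (by positivity)
    ((one_div_lt hW hβ0).1 hβ)
  -- The second bound keeps the means below 1 in absolute value; the first and third give (sB)⁴ ≤
  -- s²βη/2. The net gain is s²βη/2 - s²βη/6 per site.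
  obtain ⟨s, hs0, hs⟩ : ∃ s : ℝ, 0 < s ∧ s ≤ min 1 (min (1 / (2 * B)) (β * η / (2 * B ^ 4))) :=
    ⟨_, by positivity, le_rfl⟩
  obtain ⟨hs1, hs'⟩ := le_min_iff.1 hs
  obtain ⟨hs2, hs3⟩ := le_min_iff.1 hs'
  rw [le_div_iff₀ (by positivity)] at hs2 hs3
  refine ⟨s ^ 2 * (β * η) / 3, by positivity, ?_⟩
  filter_upwards [hev] with N ⟨u, huB, hu⟩
  have hsu : ∀ i, |s * u i| ≤ s * B := fun i => by
    rw [abs_mul, abs_of_pos hs0]; exact mul_le_mul_of_nonneg_left (huB i) hs0.le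
  refine le_trans ?_ (le_logPartition (coupling (G N)) (coupling_self _) β (fun i => s * u i)
    fun i => (hsu i).trans_lt (by nlinarith))
  have e1 : ∑ i, ∑ j, coupling (G N) i j * (s * u i) * (s * u j)
      = s ^ 2 * ∑ i, ∑ j, coupling (G N) i j * u i * u j := by
    simp only [Finset.mul_sum]
    exact Finset.sum_congr rfl fun i _ => Finset.sum_congr rfl fun j _ => by ring
  have e2 : ∑ i, ((s * u i) ^ 2 / 2 + (s * u i) ^ 4 / 3)
      ≤ s ^ 2 / 2 * ∑ i, u i ^ 2 + N * (s ^ 2 * (β * η) / 6) := by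
    have h4 : ∀ i : Fin N, (s * u i) ^ 4 / 3 ≤ s ^ 2 * (β * η) / 6 := by
      intro i
      have h5 : (s * u i) ^ 4 ≤ (s * B) ^ 4 := by
        rw [← (by decide : Even 4).pow_abs]
        exact pow_le_pow_left₀ (abs_nonneg _) (hsu i) 4
      have h6 : (s * B) ^ 4 ≤ s ^ 2 * (β * η / 2) := by
        rw [show (s * B) ^ 4 = s ^ 2 * (s * (s * B ^ 4)) by ring]
        refine mul_le_mul_of_nonneg_left ?_ (sq_nonneg s)
        have : 0 ≤ s * B ^ 4 := by positivity
        nlinarith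
      linarith
    rw [Finset.sum_add_distrib, Finset.mul_sum]
    refine add_le_add (Finset.sum_le_sum fun i _ => by rw [mul_pow]; linarith) ?_
    refine (Finset.sum_le_sum fun i _ => h4 i).trans (le_of_eq ?_)
    simp
  rw [e1]
  have h7 : ∑ i, u i ^ 2 + β * η * N ≤ β * ∑ i, ∑ j, coupling (G N) i j * u i * u j := by
    have := mul_le_mul_of_nonneg_left hu hβ0.le
    rw [mul_add, ← mul_assoc, mul_one_div_cancel hβ0.ne', one_mul] at this
    linarith
  have h8 := mul_le_mul_of_nonneg_left h7 (by positivity : 0 ≤ s ^ 2 / 2)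
  linarith

/-- Chernoff bound, tilting all the way down to inverse temperature 0, where `logPartition`
vanishes. -/
theorem isingEventProb_energy_le {N : ℕ} (J : Matrix (Fin N) (Fin N) ℝ) {β : ℝ} (hβ : 0 ≤ β)
    (a : ℝ) : isingEventProb J β {τ | energy J τ ≤ a}
      ≤ Real.exp (1 / 2 * β * a - logPartition J β) := by
  have h := isingExp_exp_energy J β 0
  rw [logPartition_zero] at h
  refine (isingEventProb_le J β _ (fun τ => Real.exp (1 / 2 * β * a) *
    Real.exp (1 / 2 * (0 - β) * energy J τ)) (fun τ => by positivity) ?_).trans (le_of_eq ?_)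
  · intro τ hτ
    rw [← Real.exp_add, Real.one_le_exp_iff]
    have := mul_le_mul_of_nonneg_left (show energy J τ ≤ a from hτ) hβ
    linarith
  · rw [isingExp_const_mul, h, ← Real.exp_add]
    congr 1; ring

/-- A non-asymptotic bound on the deviation probability of the pseudolikelihood estimator. -/
theorem isingEventProb_deviationEvent_le {N : ℕ} {J : Matrix (Fin N) (Fin N) ℝ} (hN : 0 < N)
    (hJ : ∀ i, J i i = 0) (hs : ∀ i j, J i j = J j i) (hJ1 : ∀ i j, |J i j| ≤ 1 / N)
    {β ε K : ℝ} (hβ : 0 ≤ β) (hε : 0 < ε) (hK : 0 < K) (hKβ : K / √N ≤ β) (hK1 : K / √N ≤ 1) :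
    isingEventProb J β (deviationEvent (mple J) β (√N) K)
      ≤ Real.exp (1 / 2 * β * (ε * N) - logPartition J β)
        + (8 + 4 * β) * (Real.cosh (β + 1) ^ 2 / ε ^ 2) ^ 2 / K ^ 2 := by
  have hN' : (0 : ℝ) < N := by exact_mod_cast hN
  have hsN : 0 < √(N : ℝ) := Real.sqrt_pos.2 hN'
  have hch := Real.cosh_pos (β + 1)
  set ρ : ℝ := ε ^ 2 * (K / √N / Real.cosh (β + 1) ^ 2) with hρ
  have hρ0 : 0 < ρ := by positivity
  have hsub : deviationEvent (mple J) β (√N) K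
      ⊆ {τ | energy J τ ≤ ε * N} ∪ {τ | ρ ≤ |score J τ β|} := by
    intro τ hτ
    by_contra hcon
    simp only [Set.mem_union, Set.mem_ofPred_eq, not_or, not_le] at hcon
    have hq : ε ^ 2 ≤ 1 / N * ∑ i, localField J τ i ^ 2 := by
      have h1 := sq_energy_le J τ
      have h2 : (ε * N) ^ 2 ≤ energy J τ ^ 2 :=
        pow_le_pow_left₀ (by positivity) hcon.1.le 2
      rw [one_div, ← div_eq_inv_mul, le_div_iff₀ hN']
      have h3 : N * (ε ^ 2 * N) ≤ N * ∑ i, localField J τ i ^ 2 := by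
        calc _ = (ε * N) ^ 2 := by ring
          _ ≤ _ := h2.trans h1
      exact le_of_mul_le_mul_left h3 hN'
    obtain ⟨htop, hdev⟩ := mple_mem_of_score hJ1 τ (r := K / √N) (by positivity) hKβ hK1
      (hcon.2.trans_le (by rw [hρ]; gcongr))
    rcases hτ with h | h
    · exact htop h
    · have := mul_le_mul_of_nonneg_left hdev hsN.le
      rw [mul_div_cancel₀ _ hsN.ne'] at this
      linarith
  refine (isingEventProb_mono J β hsub).trans ((isingEventProb_union_le J β _ _).trans ?_)
  refine add_le_add (isingEventProb_energy_le J hβ _) ?_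
  refine (isingEventProb_le J β _ (fun τ => 1 / ρ ^ 2 * score J τ β ^ 2)
    (fun τ => by positivity) ?_).trans ?_
  · intro τ hτ
    rw [one_div, ← div_eq_inv_mul, le_div_iff₀ (by positivity), one_mul, ← sq_abs (score J τ β)]
    exact pow_le_pow_left₀ hρ0.le hτ 2
  · rw [isingExp_const_mul]
    refine (mul_le_mul_of_nonneg_left (isingExp_score_sq_le hN hJ hs hJ1 hβ)
      (by positivity)).trans (le_of_eq ?_)
    have e : ρ ^ 2 = (ε ^ 2 / Real.cosh (β + 1) ^ 2) ^ 2 * (K ^ 2 / N) := by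
      rw [hρ, ← Real.sq_sqrt hN'.le]
      rw [Real.sqrt_sq hsN.le]
      field_simp
    rw [e]
    field_simp

theorem isConsistentAtRate_mple {G : ∀ N : ℕ, SimpleGraph (Fin N)} {W : Graphon}
    (hG : ConvergesInCutMetric G W) (hW : 0 < graphonNorm W) {β : ℝ}
    (hβ : 1 / graphonNorm W < β) :
    IsConsistentAtRate (fun N => coupling (G N)) (fun N => mple (coupling (G N)))
      (fun N => √(N : ℝ)) β := by
  have hβ0 : 0 < β := lt_trans (by positivity) hβ
  obtain ⟨κ, hκ, hev⟩ := exists_eventually_logPartition_ge hG hW hβ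
  -- Then ½βεN is half of the lower bound κN, so the low-energy event has probability at most
  -- exp(-κN/2).
  set ε : ℝ := κ / β with hε
  have hε0 : 0 < ε := by positivity
  set C : ℝ := (8 + 4 * β) * (Real.cosh (β + 1) ^ 2 / ε ^ 2) ^ 2 with hC
  have hsqrt : Tendsto (fun N : ℕ => √(N : ℝ)) atTop atTop :=
    Real.tendsto_sqrt_atTop.comp tendsto_natCast_atTop_atTop
  have hexp : Tendsto (fun N : ℕ => Real.exp (-(κ / 2 * N))) atTop (𝓝 0) :=
    Real.tendsto_exp_neg_atTop_nhds_zero.comp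
      (tendsto_natCast_atTop_atTop.const_mul_atTop (by positivity))
  -- For fixed K the exponential term eventually drops below 1/K²; this is the 1 in 1 + C.
  have hbound : ∀ K : ℝ, 0 < K → ∀ᶠ N : ℕ in atTop, isingEventProb (coupling (G N)) β
      (deviationEvent (mple (coupling (G N))) β (√(N : ℝ)) K) ≤ (1 + C) / K ^ 2 := by
    intro K hK
    have hKN : Tendsto (fun N : ℕ => K / √(N : ℝ)) atTop (𝓝 0) := hsqrt.const_div_atTop K
    filter_upwards [hev, eventually_gt_atTop 0, hKN.eventually_le_const hβ0,
      hKN.eventually_le_const one_pos,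
      hexp.eventually_le_const (show 0 < 1 / K ^ 2 by positivity)] with N h1 hN h2 h3 h4
    refine (isingEventProb_deviationEvent_le hN (coupling_self _) (coupling_comm _)
      (fun i j => by rw [abs_of_nonneg (coupling_nonneg _ i j)]; exact coupling_le _ i j)
      hβ0.le hε0 hK h2 h3).trans ?_
    rw [add_div, ← hC]
    refine add_le_add_left (le_trans (Real.exp_le_exp.2 ?_) h4) _
    have e : 1 / 2 * β * (ε * N) = κ / 2 * N := by rw [hε]; field_simp
    rw [e]; linarith
  have hnonneg : ∀ (K : ℝ) (N : ℕ), 0 ≤ isingEventProb (coupling (G N)) β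
      (deviationEvent (mple (coupling (G N))) β (√(N : ℝ)) K) :=
    fun K N => isingEventProb_nonneg _ _ _
  have hlim : Tendsto (fun K : ℝ => (1 + C) / K ^ 2) atTop (𝓝 0) :=
    (tendsto_pow_atTop two_ne_zero).const_div_atTop _
  refine Tendsto.limsup_eq (tendsto_of_tendsto_of_tendsto_of_le_of_le' tendsto_const_nhds hlim
    ?_ ?_)
  -- A real-valued limsup is meaningful only for bounded families, so each comparison also supplies
  -- a bound on the other side.
  · filter_upwards [eventually_gt_atTop 0] with K hK
    exact le_limsup_of_frequently_le (Frequently.of_forall fun N => hnonneg K N)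
      ⟨_, eventually_map.2 (hbound K hK)⟩
  · filter_upwards [eventually_gt_atTop 0] with K hK
    exact limsup_le_of_le (isCoboundedUnder_le_of_le atTop fun N => hnonneg K N) (hbound K hK)

end IsingGraphon

theorem theorem4 (G : ∀ N : ℕ, SimpleGraph (Fin N)) (W : IsingGraphon.Graphon)
    (hG : IsingGraphon.ConvergesInCutMetric G W)
    (hW : 0 < ∫ p : unitInterval × unitInterval, W.toFun p.1 p.2) :
    (∀ β₁ β₂ : ℝ, 0 ≤ β₁ → β₁ < β₂ → β₂ < 1 / IsingGraphon.graphonNorm W →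
      ¬ ∃ φ : ∀ N : ℕ, IsingGraphon.Spins N → Fin 2,
        IsingGraphon.IsConsistentTest (fun N => IsingGraphon.coupling (G N)) β₁ β₂ φ) ∧
    (∀ β₀ : ℝ, 1 / IsingGraphon.graphonNorm W < β₀ →
      IsingGraphon.IsConsistentAtRate (fun N => IsingGraphon.coupling (G N))
        (fun N => IsingGraphon.mple (IsingGraphon.coupling (G N)))
        (fun N => Real.sqrt (N : ℝ)) β₀) := by
  have hpos := IsingGraphon.graphonNorm_pos W hW
  exact ⟨fun _ _ h0 h12 h2 => IsingGraphon.not_exists_isConsistentTest hG hpos h0 h12 h2,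
    fun _ hβ => IsingGraphon.isConsistentAtRate_mple hG hpos hβ⟩
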